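/- Let $\sigma:\mathbb{R}\to\mathbb{R}$ be smooth ($C^\infty$), nonpolynomial and Lipschitz continuous; $\sigma$ is applied componentwise to vectors. Let $\Omega\subset\mathbb{R}^d$ be a bounded Lipschitz domain, i.e. $\Omega$ is open, $\overline\Omega$ is compact, and near each of its points $\partial\Omega$ is, after a rotation of coordinates, the graph of a Lipschitz function with $\Omega$ lying on one side of it (connectedness is not needed). For an integer $s\ge 0$, let $C^s(\overline\Omega;\mathbb{R}^k)$ be the space of functions that are $s$ times continuously differentiable in $\Omega$ and whose partial derivatives of order at most $s$ all extend continuously to $\overline\Omega$, with the norm $\|u\|_{C^s}=\max_{|\alpha|\le s}\sup_{x\in\overline\Omega}|D^\alpha u(x)|$. An averaging neural operator with channel dimension $d_c\in\mathbb{N}$ is a map $u\mapsto\Psi(u)$ of the form \[ v(x)=R(u(x),x),\qquad w(x)=\sigma\Big(Wv(x)+b+\frac1{|\Omega|}\int_\Omega v(y)\,dy\Big),\qquad \Psi(u)(x)=Q(w(x),x), \] where $W\in\mathbb{R}^{d_c\times d_c}$, $b\in\mathbb{R}^{d_c}$, and $R:\mathbb{R}^k\times\mathbb{R}^d\to\mathbb{R}^{d_c}$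 and $Q:\mathbb{R}^{d_c}\times\mathbb{R}^d\to\mathbb{R}^{k'}$ are neural networks with activation $\sigma$ and one hidden layer of width $d_c$, that is, maps of the form $z\mapsto A_2\,\sigma(A_1z+b_1)+b_2$ with $b_1\in\mathbb{R}^{d_c}$. Let $s,s'\ge 0$ be integers, let $\Psi^\dagger: C^s(\overline\Omega;\mathbb{R}^k)\to C^{s'}(\overline\Omega;\mathbb{R}^{k'})$ be a continuous (not necessarily linear) operator, and let $\mathsf K\subset C^s(\overline\Omega;\mathbb{R}^k)$ be compact. Then for every $\epsilon>0$ there is an averaging neural operator $\Psi$ that maps $C^s(\overline\Omega;\mathbb{R}^k)$ into $C^{s'}(\overline\Omega;\mathbb{R}^{k'})$ and satisfies \[ \sup_{u\in\mathsf K}\|\Psi^\dagger(u)-\Psi(u)\|_{C^{s'}}\le\epsilon . \] -/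

import Mathlib

open MeasureTheory
open scoped ContDiff NNReal Polynomial Matrix

noncomputable section

namespace ANO

/-- `ℝⁿ` with the Euclidean norm. -/
abbrev E (n : ℕ) : Type := EuclideanSpace ℝ (Fin n)

/-- `∂Ω` is locally the graph of a Lipschitz function, with `Ω` on one side of it: near every
boundary point there are a unit vector `e` and a Lipschitz function `γ` on the hyperplane `eᗮ` such
that `Ω` consists of the points whose `e`-coordinate exceeds the value of `γ` at the projection. -/
def HasLipschitzBoundary {d : ℕ} (Ω : Set (E d)) : Prop :=
  ∀ x₀ ∈ frontier Ω, ∃ V : Set (E d), IsOpen V ∧ x₀ ∈ V ∧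
    ∃ e : E d, ‖e‖ = 1 ∧ ∃ (L : ℝ≥0) (γ : (ℝ ∙ e)ᗮ → ℝ), LipschitzWith L γ ∧
      ∀ y ∈ V, y ∈ Ω ↔ γ ((ℝ ∙ e)ᗮ.orthogonalProjectionOnto y) < inner ℝ e y

/-- Bounded Lipschitz domains. Connectedness is not required. -/
structure IsBoundedLipschitzDomain {d : ℕ} (Ω : Set (E d)) : Prop where
  isOpen : IsOpen Ω
  isCompact_closure : IsCompact (closure Ω)
  lipschitz : HasLipschitzBoundary Ω

/-- Lists `(i₁, …, i_m)` of coordinate directions, of length `m ≤ s`; they index the partial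
derivatives `∂_{i₁} ⋯ ∂_{i_m}` of order at most `s`. -/
abbrev Dirs (d s : ℕ) : Type := Σ m : Fin (s + 1), (Fin m.val → Fin d)

/-- The empty list of directions (no derivative). -/
def Dirs.nil (d s : ℕ) : Dirs d s := ⟨⟨0, Nat.succ_pos s⟩, Fin.elim0⟩

/-- The partial derivative `∂_{i₁} ⋯ ∂_{i_m} U (x)`. -/
def partialD {d k s : ℕ} (I : Dirs d s) (U : E d → E k) (x : E d) : E k :=
  iteratedFDeriv ℝ I.1.val U x (fun j => EuclideanSpace.single (I.2 j) (1 : ℝ))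

theorem partialD_nil {d k s : ℕ} (U : E d → E k) (x : E d) :
    partialD (Dirs.nil d s) U x = U x :=
  iteratedFDeriv_zero_apply _

theorem partialD_add {d k s : ℕ} {Ω : Set (E d)} (hΩ : IsOpen Ω) {U V : E d → E k}
    (hU : ContDiffOn ℝ s U Ω) (hV : ContDiffOn ℝ s V Ω) (I : Dirs d s) {x : E d} (hx : x ∈ Ω) :
    partialD I (U + V) x = partialD I U x + partialD I V x := by
  have hm : ((I.1.val : ℕ) : WithTop ℕ∞) ≤ (s : WithTop ℕ∞) := by
    exact_mod_cast Nat.lt_succ_iff.mp I.1.2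
  have hu : ContDiffAt ℝ I.1.val U x := (hU.contDiffAt (hΩ.mem_nhds hx)).of_le hm
  have hv : ContDiffAt ℝ I.1.val V x := (hV.contDiffAt (hΩ.mem_nhds hx)).of_le hm
  simp only [partialD]
  rw [iteratedFDeriv_add_apply hu hv]
  rfl

theorem partialD_smul {d k s : ℕ} {Ω : Set (E d)} (hΩ : IsOpen Ω) (c : ℝ) {U : E d → E k}
    (hU : ContDiffOn ℝ s U Ω) (I : Dirs d s) {x : E d} (hx : x ∈ Ω) :
    partialD I (c • U) x = c • partialD I U x := by
  have hm : ((I.1.val : ℕ) : WithTop ℕ∞) ≤ (s : WithTop ℕ∞) := by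
    exact_mod_cast Nat.lt_succ_iff.mp I.1.2
  have hu : ContDiffAt ℝ I.1.val U x := (hU.contDiffAt (hΩ.mem_nhds hx)).of_le hm
  simp only [partialD]
  rw [iteratedFDeriv_const_smul_apply hu]
  rfl

/-- The space `C^s(Ω̄; ℝᵏ)` for `Ω` an open set: functions that are `s` times continuously
differentiable in `Ω` and all of whose partial derivatives of order at most `s` extend to (bounded)
continuous functions on `Ω̄`. An element is recorded as the family of these extensions, which is
determined by the function itself (see `CBar.ext_fn`); the ambient norm is then
`max_{|α| ≤ s} sup_{x ∈ Ω̄} |∂^α u(x)|`. -/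
def cBarSubmodule (d k s : ℕ) (Ω : TopologicalSpace.Opens (E d)) :
    Submodule ℝ (Dirs d s → BoundedContinuousFunction (closure (Ω : Set (E d))) (E k)) where
  carrier := {g | ∃ U : E d → E k, ContDiffOn ℝ s U (Ω : Set (E d)) ∧
    ∀ (I : Dirs d s) (x : E d) (hx : x ∈ (Ω : Set (E d))),
      g I ⟨x, subset_closure hx⟩ = partialD I U x}
  zero_mem' := ⟨0, contDiffOn_const, fun I x _ => by
    have h : (0 : E d → E k) = fun _ => (0 : E k) := rfl
    simp [partialD, h]⟩
  add_mem' := by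
    rintro g h ⟨U, hU, hg⟩ ⟨V, hV, hh⟩
    refine ⟨U + V, hU.add hV, fun I x hx => ?_⟩
    rw [partialD_add Ω.isOpen hU hV I hx, ← hg I x hx, ← hh I x hx]
    rfl
  smul_mem' := by
    rintro c g ⟨U, hU, hg⟩
    refine ⟨c • U, contDiffOn_const.smul hU, fun I x hx => ?_⟩
    rw [partialD_smul Ω.isOpen c hU I hx, ← hg I x hx]
    rfl

/-- `C^s(Ω̄; ℝᵏ)` with its norm. -/
abbrev CBar (d k s : ℕ) (Ω : TopologicalSpace.Opens (E d)) : Type := cBarSubmodule d k s Ω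

/-- The function `Ω̄ → ℝᵏ` given by an element of `C^s(Ω̄; ℝᵏ)`. -/
def CBar.fn {d k s : ℕ} {Ω : TopologicalSpace.Opens (E d)} (u : CBar d k s Ω) :
    closure (Ω : Set (E d)) → E k :=
  u.1 (Dirs.nil d s)

theorem CBar.ext_fn {d k s : ℕ} {Ω : TopologicalSpace.Opens (E d)} {u v : CBar d k s Ω}
    (h : u.fn = v.fn) : u = v := by
  obtain ⟨U, -, hu⟩ := u.2
  obtain ⟨V, -, hv⟩ := v.2
  have hUV : Set.EqOn U V (Ω : Set (E d)) := fun x hx => by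
    have h1 := hu (Dirs.nil d s) x hx
    have h2 := hv (Dirs.nil d s) x hx
    rw [partialD_nil] at h1 h2
    rw [← h1, ← h2]
    exact congrFun h _
  refine Subtype.ext (funext fun I => DFunLike.coe_injective ?_)
  have hd : DenseRange (Set.inclusion (subset_closure (s := (Ω : Set (E d))))) :=
    (denseRange_inclusion_iff subset_closure).2 subset_rfl
  refine hd.equalizer (u.1 I).continuous (v.1 I).continuous (funext fun x => ?_)
  have h1 := hu I x.1 x.2
  have h2 := hv I x.1 x.2
  have h3 : partialD I U x.1 = partialD I V x.1 := by
    have : U =ᶠ[nhds x.1] V := Filter.eventuallyEq_of_mem (Ω.isOpen.mem_nhds x.2) hUV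
    simp only [partialD]
    rw [(this.iteratedFDeriv ℝ I.1.val).eq_of_nhds]
  exact h1.trans (h3.trans h2.symm)

/-- Admissible activation functions: smooth, nonpolynomial and Lipschitz continuous. -/
structure IsActivation (σ : ℝ → ℝ) : Prop where
  smooth : ContDiff ℝ ∞ σ
  nonpolynomial : ¬ ∃ p : ℝ[X], ∀ t : ℝ, σ t = p.eval t
  lipschitz : ∃ L : ℝ≥0, LipschitzWith L σ

/-- Weights and biases of a neural network `ℝᵖ × ℝᵈ → ℝ^q` with one hidden layer of width `w`. -/
structure ShallowNet (p d w q : ℕ) where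
  A₁ : Matrix (Fin w) (Fin p ⊕ Fin d) ℝ
  b₁ : Fin w → ℝ
  A₂ : Matrix (Fin q) (Fin w) ℝ
  b₂ : Fin q → ℝ

/-- The network function `(v, x) ↦ A₂ σ(A₁ (v, x) + b₁) + b₂`, with `σ` acting componentwise. -/
def ShallowNet.eval {p d w q : ℕ} (σ : ℝ → ℝ) (N : ShallowNet p d w q) (v : E p) (x : E d) : E q :=
  WithLp.toLp 2 (N.A₂ *ᵥ (fun i => σ ((N.A₁ *ᵥ Sum.elim v.ofLp x.ofLp + N.b₁) i)) + N.b₂)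

/-- The hidden layer `v ↦ σ(W v(x) + b + ⨍_Ω v(y) dy)`, with `σ` acting componentwise. -/
def avgLayer {d c : ℕ} (Ω : TopologicalSpace.Opens (E d)) (σ : ℝ → ℝ)
    (W : Matrix (Fin c) (Fin c) ℝ) (b : Fin c → ℝ) (v : closure (Ω : Set (E d)) → E c)
    (x : closure (Ω : Set (E d))) : E c :=
  WithLp.toLp 2 fun i => σ ((W *ᵥ (v x).ofLp) i + b i +
    ⨍ y, v (Set.inclusion subset_closure y) i
      ∂(Measure.comap (Subtype.val : ↥(Ω : Set (E d)) → E d) volume))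

/-- Tunable parameters of an averaging neural operator with channel dimension `c` acting on
`ℝᵏ`-valued functions on a subset of `ℝᵈ`, with `ℝ^{k'}`-valued output: the lifting network `R` and
the projection network `Q`, each with one hidden layer of width `c`, and the weight matrix and the
bias of the averaging layer. -/
structure Params (d k k' c : ℕ) where
  R : ShallowNet k d c c
  W : Matrix (Fin c) (Fin c) ℝ
  b : Fin c → ℝ
  Q : ShallowNet c d c k'

/-- The averaging neural operator: lifting `v(x) = R(u(x), x)`, one averaging layer, and the
projection `v(x) ↦ Q(v(x), x)`. -/
def Params.apply {d k k' c : ℕ} (θ : Params d k k' c) (Ω : TopologicalSpace.Opens (E d))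
    (σ : ℝ → ℝ) (u : closure (Ω : Set (E d)) → E k) (x : closure (Ω : Set (E d))) : E k' :=
  θ.Q.eval σ (avgLayer Ω σ θ.W θ.b (fun y => θ.R.eval σ (u y) y.1) x) x.1

end ANO

end

/-! A continuous map on a compact set is nearly of finite rank: a partition of unity on `K` gives
`Ψd u ≈ ∑ α_j(u) Ψd(u_j)` with scalar continuous `α_j` (`exists_finite_rank_approx`). It remains to
make the functions `Ψd(u_j)` and the coefficients `α_j` accessible to networks.

The functions are replaced by polynomials `q_j`, dense in $C^{s'}(\overline\Omega)$
(`CBar.exists_polyFun_approx`). The Lipschitz boundary enters here: translating locally into Ω turns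
a function on Ω into one that is smooth near the closure, and convolution with Landau kernels then
yields polynomials.

The coefficients are replaced by polynomials in features `u ↦ σ(b + ⨍ R(u(y), y) dy)` with `R` a
shallow network. By Stone–Weierstrass it suffices that features separate points. If all averages of
networks agreed at `u` and `v`, then so would all averages of polynomials in `(u(y), y)`; testing
with `u_i(y) q(y)` makes `u - v` orthogonal to every polynomial, so `u = v` (`exists_ridge_avg_ne`).

The outcome `∑ p_j(w) q_j(x)` is a polynomial in the feature vector `w` and in `x`. Shallow networks
approximate polynomials on compact sets with all derivatives up to a given order
(`polyFun_le_crClosure_ridge`), so one output network `Q(w, x)` replaces it. With `W = 0` the hidden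
state does not depend on `x`, so the output is smooth in `x` through `Q` alone (`exists_params`). -/

namespace ANO

/-! ### Smooth Taylor remainders -/

section Hadamard

/-- Differentiating under the integral sign produces integrals of the same shape, with `g` replaced
by `deriv g` and the weight by `m τ` or `m τ * τ`. The weight is there to close the induction. -/
theorem contDiff_integral_comp_line (n : ℕ) : ∀ {g m : ℝ → ℝ}, ContDiff ℝ ∞ g → Continuous m →
    ContDiff ℝ n (fun p : ℝ × ℝ => ∫ τ in (0 : ℝ)..1, m τ * g (p.1 + τ * p.2)) := by
  induction n with
  | zero =>
    intro g m hg hm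
    have hg' := hg.continuous
    rw [Nat.cast_zero, contDiff_zero]
    exact intervalIntegral.continuous_parametric_intervalIntegral_of_continuous' (by fun_prop) 0 1
  | succ n ih =>
    intro g m hg hm
    have hgd := (contDiff_infty_iff_deriv.1 hg).1
    have hg' := (contDiff_infty_iff_deriv.1 hg).2
    have hgc := hg.continuous
    have hgc' := hg'.continuous
    rw [Nat.cast_succ, contDiff_succ_iff_hasFDerivAt]
    let F' : ℝ × ℝ → ℝ → (ℝ × ℝ →L[ℝ] ℝ) := fun p τ =>
      (m τ * deriv g (p.1 + τ * p.2)) • ContinuousLinearMap.fst ℝ ℝ ℝ +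
        ((m τ * τ) * deriv g (p.1 + τ * p.2)) • ContinuousLinearMap.snd ℝ ℝ ℝ
    have hF'c : Continuous (Function.uncurry F') := by
      simp only [F', Function.uncurry_def]; fun_prop
    refine ⟨fun p => (∫ τ in (0 : ℝ)..1, m τ * deriv g (p.1 + τ * p.2)) •
        ContinuousLinearMap.fst ℝ ℝ ℝ + (∫ τ in (0 : ℝ)..1, (m τ * τ) * deriv g (p.1 + τ * p.2)) •
        ContinuousLinearMap.snd ℝ ℝ ℝ, ?_, fun p => ?_⟩
    · exact ((ih hg' hm).smul contDiff_const).add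
        ((ih hg' (hm.mul continuous_id)).smul contDiff_const)
    · have h_int : ∫ τ in (0 : ℝ)..1, F' p τ = (∫ τ in (0 : ℝ)..1, m τ * deriv g (p.1 + τ * p.2)) •
          ContinuousLinearMap.fst ℝ ℝ ℝ + (∫ τ in (0 : ℝ)..1, (m τ * τ) *
          deriv g (p.1 + τ * p.2)) • ContinuousLinearMap.snd ℝ ℝ ℝ := by
        simp only [F']
        rw [intervalIntegral.integral_add, intervalIntegral.integral_smul_const,
          intervalIntegral.integral_smul_const]
        · exact Continuous.intervalIntegrable (by fun_prop) _ _
        · exact Continuous.intervalIntegrable (by fun_prop) _ _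
      change HasFDerivAt _ (_ + _) p
      rw [← h_int]
      obtain ⟨M, hM⟩ := (((isCompact_closedBall p 1).prod
        (isCompact_Icc (a := (0 : ℝ)) (b := 1))).exists_bound_of_continuousOn hF'c.continuousOn)
      refine intervalIntegral.hasFDerivAt_integral_of_dominated_of_fderiv_le (F' := F')
        (bound := fun _ => M) (Metric.closedBall_mem_nhds p one_pos) ?_ ?_ ?_ ?_ ?_ ?_
      · exact Filter.Eventually.of_forall fun q =>
          Continuous.aestronglyMeasurable (by fun_prop)
      · exact Continuous.intervalIntegrable (by fun_prop) _ _
      · exact Continuous.aestronglyMeasurable (hF'c.comp (by fun_prop : Continuous fun τ => (p, τ)))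
      · refine Filter.Eventually.of_forall fun τ hτ q hq => hM (q, τ) ⟨hq, ?_⟩
        rw [Set.uIoc_of_le zero_le_one] at hτ
        exact ⟨hτ.1.le, hτ.2⟩
      · exact intervalIntegrable_const
      · refine Filter.Eventually.of_forall fun τ _ q _ => ?_
        have h1 : HasFDerivAt (fun q : ℝ × ℝ => q.1 + τ * q.2)
            (ContinuousLinearMap.fst ℝ ℝ ℝ + τ • ContinuousLinearMap.snd ℝ ℝ ℝ) q :=
          hasFDerivAt_fst.add (hasFDerivAt_snd.const_mul τ)
        have h2 := ((hgd (q.1 + τ * q.2)).hasDerivAt.comp_hasFDerivAt q h1).const_mul (m τ)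
        have h3 : F' q τ = m τ • deriv g (q.1 + τ * q.2) •
            (ContinuousLinearMap.fst ℝ ℝ ℝ + τ • ContinuousLinearMap.snd ℝ ℝ ℝ) := by
          ext <;> simp [F']; ring
        rw [h3]
        exact h2

/-- First order Taylor expansion with a smooth remainder. -/
theorem exists_contDiff_hadamard {g : ℝ → ℝ} (hg : ContDiff ℝ ∞ g) :
    ∃ ρ : ℝ × ℝ → ℝ, ContDiff ℝ ∞ ρ ∧ (∀ a h, g (a + h) - g a = h * ρ (a, h)) ∧
      ∀ a, ρ (a, 0) = deriv g a := by
  have hgd := (contDiff_infty_iff_deriv.1 hg).1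
  have hg' := (contDiff_infty_iff_deriv.1 hg).2
  -- The factor `1` is the weight `m` of `contDiff_integral_comp_line`.
  refine ⟨fun p => ∫ τ in (0 : ℝ)..1, 1 * deriv g (p.1 + τ * p.2), ?_, fun a h => ?_, fun a => ?_⟩
  · exact contDiff_infty.2 fun n => contDiff_integral_comp_line n hg' continuous_const
  · simp only [one_mul]
    rw [← intervalIntegral.integral_const_mul]
    have : ∀ τ ∈ Set.uIcc (0 : ℝ) 1, HasDerivAt (fun τ => g (a + τ * h))
        (h * deriv g (a + τ * h)) τ := fun τ _ => by
      have := (hgd (a + τ * h)).hasDerivAt.comp τ (((hasDerivAt_id τ).mul_const h).const_add a)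
      simpa [mul_comm, Function.comp_def] using this
    have hc := hg'.continuous
    rw [intervalIntegral.integral_eq_sub_of_hasDerivAt this
      (Continuous.intervalIntegrable (by fun_prop) _ _)]
    simp
  · simp

end Hadamard

/-! ### Closure in the $C^r$ topology on a compact set -/

section CrClosure

variable {F : Type*} [NormedAddCommGroup F] [NormedSpace ℝ F]

/-- The smooth functions that can be approximated by smooth elements of `S`, uniformly on `C`
together with their derivatives of order at most `r`. -/
def crClosure (r : ℕ) (C : Set F) (S : Submodule ℝ (F → ℝ)) : Submodule ℝ (F → ℝ) where
  carrier := {f | ContDiff ℝ ∞ f ∧ ∀ ε > 0, ∃ g ∈ S, ContDiff ℝ ∞ g ∧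
    ∀ z ∈ C, ∀ i ≤ r, ‖iteratedFDeriv ℝ i (f - g) z‖ ≤ ε}
  zero_mem' := ⟨contDiff_const, fun ε hε => ⟨0, S.zero_mem, contDiff_const, fun z _ i _ => by
    simp [hε.le]⟩⟩
  add_mem' := by
    rintro f₁ f₂ ⟨h₁, H₁⟩ ⟨h₂, H₂⟩
    refine ⟨h₁.add h₂, fun ε hε => ?_⟩
    obtain ⟨g₁, hg₁, hs₁, hb₁⟩ := H₁ (ε / 2) (half_pos hε)
    obtain ⟨g₂, hg₂, hs₂, hb₂⟩ := H₂ (ε / 2) (half_pos hε)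
    refine ⟨g₁ + g₂, S.add_mem hg₁ hg₂, hs₁.add hs₂, fun z hz i hi => ?_⟩
    rw [add_sub_add_comm, iteratedFDeriv_add_apply (f := f₁ - g₁) (g := f₂ - g₂)
      ((h₁.sub hs₁).contDiffAt.of_le (mod_cast le_top))
      ((h₂.sub hs₂).contDiffAt.of_le (mod_cast le_top))]
    exact (norm_add_le _ _).trans (by linarith [hb₁ z hz i hi, hb₂ z hz i hi])
  smul_mem' := by
    rintro c f ⟨h, H⟩
    refine ⟨contDiff_const.smul h, fun ε hε => ?_⟩
    obtain ⟨g, hg, hs, hb⟩ := H (ε / (|c| + 1)) (by positivity)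
    refine ⟨c • g, S.smul_mem c hg, contDiff_const.smul hs, fun z hz i hi => ?_⟩
    rw [← smul_sub, iteratedFDeriv_const_smul_apply (f := f - g)
      ((h.sub hs).contDiffAt.of_le (mod_cast le_top)), norm_smul, Real.norm_eq_abs]
    calc |c| * ‖iteratedFDeriv ℝ i (f - g) z‖ ≤ (|c| + 1) * (ε / (|c| + 1)) := by
          gcongr
          · linarith
          · exact hb z hz i hi
      _ = ε := by field_simp

theorem mem_crClosure_of_mem {r : ℕ} {C : Set F} {S : Submodule ℝ (F → ℝ)} {f : F → ℝ}
    (hf : ContDiff ℝ ∞ f) (hS : f ∈ S) : f ∈ crClosure r C S :=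
  ⟨hf, fun ε hε => ⟨f, hS, hf, fun z _ i _ => by
    have h : f - f = fun _ => 0 := by ext; simp
    have : iteratedFDeriv ℝ i (f - f) z = 0 := by rw [h]; simp
    rw [this, norm_zero]; exact hε.le⟩⟩

theorem mem_crClosure_of_forall_exists {r : ℕ} {C : Set F} {S : Submodule ℝ (F → ℝ)} {f : F → ℝ}
    (hf : ContDiff ℝ ∞ f) (h : ∀ ε > 0, ∃ g ∈ crClosure r C S,
      ∀ z ∈ C, ∀ i ≤ r, ‖iteratedFDeriv ℝ i (f - g) z‖ ≤ ε) : f ∈ crClosure r C S := by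
  refine ⟨hf, fun ε hε => ?_⟩
  obtain ⟨g₁, ⟨hs₁, H⟩, hb₁⟩ := h (ε / 2) (half_pos hε)
  obtain ⟨g₂, hg₂, hs₂, hb₂⟩ := H (ε / 2) (half_pos hε)
  refine ⟨g₂, hg₂, hs₂, fun z hz i hi => ?_⟩
  rw [← sub_add_sub_cancel f g₁ g₂, iteratedFDeriv_add_apply (f := f - g₁) (g := g₁ - g₂)
      ((hf.sub hs₁).contDiffAt.of_le (mod_cast le_top))
      ((hs₁.sub hs₂).contDiffAt.of_le (mod_cast le_top))]
  exact (norm_add_le _ _).trans (by linarith [hb₁ z hz i hi, hb₂ z hz i hi])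

/-- The derivatives of a partial map `z ↦ B (a, z)` are restrictions of those of `B`. -/
theorem iteratedFDeriv_prodMk_left {G H : Type*} [NormedAddCommGroup G] [NormedSpace ℝ G]
    [NormedAddCommGroup H] [NormedSpace ℝ H] {n : WithTop ℕ∞}
    {B : G × F → H} (hB : ContDiff ℝ n B) (a : G) (z : F) {i : ℕ} (hi : i ≤ n) :
    iteratedFDeriv ℝ i (fun z => B (a, z)) z =
      (iteratedFDeriv ℝ i B (a, z)).compContinuousLinearMap
        fun _ => ContinuousLinearMap.inr ℝ G F := by
  have h1 : (fun z => B (a, z)) =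
      (fun p => B ((a, 0) + p)) ∘ (ContinuousLinearMap.inr ℝ G F) := by
    ext z; simp
  rw [h1, ContinuousLinearMap.iteratedFDeriv_comp_right _ (n := n) (f := fun p => B ((a, 0) + p))
    (hB.comp (contDiff_const.add contDiff_id)) _ hi, iteratedFDeriv_comp_add_left]
  simp

theorem norm_iteratedFDeriv_prodMk_left_le {G H : Type*} [NormedAddCommGroup G] [NormedSpace ℝ G]
    [NormedAddCommGroup H] [NormedSpace ℝ H] {n : WithTop ℕ∞}
    {B : G × F → H} (hB : ContDiff ℝ n B) (a : G) (z : F) {i : ℕ} (hi : i ≤ n) :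
    ‖iteratedFDeriv ℝ i (fun z => B (a, z)) z‖ ≤ ‖iteratedFDeriv ℝ i B (a, z)‖ := by
  rw [iteratedFDeriv_prodMk_left hB a z hi]
  refine (ContinuousMultilinearMap.norm_compContinuousLinearMap_le _ _).trans ?_
  refine mul_le_of_le_one_right (norm_nonneg _) (Finset.prod_le_one (fun _ _ => norm_nonneg _) ?_)
  exact fun _ _ => ContinuousLinearMap.norm_inr_le_one ℝ G F

/-- The `z`-derivatives of `B (0, z) - B (t, z)` are jointly continuous in `(t, z)` and vanish at `t
= 0`, so the tube lemma makes them small on `C` for small `t`. This lets difference quotients (`t ≠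
0`) pass to derivatives (`t = 0`). -/
theorem mem_crClosure_of_param {r : ℕ} {C : Set F} (hC : IsCompact C) {S : Submodule ℝ (F → ℝ)}
    {B : ℝ × F → ℝ} (hB : ContDiff ℝ ∞ B)
    (h : ∀ t ≠ 0, (fun z => B (t, z)) ∈ crClosure r C S) :
    (fun z => B (0, z)) ∈ crClosure r C S := by
  have hpt : ∀ t, ContDiff ℝ ∞ fun z => B (t, z) := fun t =>
    hB.comp (contDiff_const.prodMk contDiff_id)
  refine mem_crClosure_of_forall_exists (hpt 0) fun ε hε => ?_
  have key : ∀ i : ℕ, ∀ᶠ t in nhds (0 : ℝ), ∀ z ∈ C,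
      ‖iteratedFDeriv ℝ i ((fun z => B (0, z)) - fun z => B (t, z)) z‖ < ε := by
    intro i
    have hi : (i : WithTop ℕ∞) ≤ ∞ := mod_cast le_top
    let D : ℝ × F → ℝ := fun p => B (0, p.2) - B p
    have hD : ContDiff ℝ ∞ D := ((hpt 0).comp contDiff_snd).sub hB
    let G : ℝ × F → ℝ := fun p => ‖iteratedFDeriv ℝ i (fun z => D (p.1, z)) p.2‖
    have hG : Continuous G := by
      have : G = fun p => ‖(iteratedFDeriv ℝ i D p).compContinuousLinearMap
        fun _ => ContinuousLinearMap.inr ℝ ℝ F‖ := by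
        ext p; simp only [G]; rw [iteratedFDeriv_prodMk_left hD p.1 p.2 hi]
      rw [this]
      exact ((ContinuousMultilinearMap.compContinuousLinearMapL
        (fun _ : Fin i => ContinuousLinearMap.inr ℝ ℝ F)).continuous.comp
        (hD.continuous_iteratedFDeriv (m := i) hi)).norm
    obtain ⟨u, v, hu, -, h0u, hCv, huv⟩ := generalized_tube_lemma (isCompact_singleton (x := (0 : ℝ)))
      hC (isOpen_Iio.preimage hG : IsOpen (G ⁻¹' Set.Iio ε)) (by
        rintro ⟨t, z⟩ ⟨ht, -⟩
        obtain rfl : t = 0 := ht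
        have : (fun z => D (0, z)) = fun _ => 0 := by ext; simp [D]
        simp [G, this, hε])
    filter_upwards [hu.mem_nhds (h0u rfl)] with t ht z hz
    have e : ((fun z => B (0, z)) - fun z => B (t, z)) = fun z => D (t, z) := rfl
    rw [e]
    have hmem : (t, z) ∈ G ⁻¹' Set.Iio ε := huv (Set.mk_mem_prod ht (hCv hz))
    exact hmem
  have key' : ∀ᶠ t in nhds (0 : ℝ), ∀ i ∈ Finset.range (r + 1), ∀ z ∈ C,
      ‖iteratedFDeriv ℝ i ((fun z => B (0, z)) - fun z => B (t, z)) z‖ < ε :=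
    (Finset.eventually_all _).2 fun i _ => key i
  obtain ⟨t, ht, ht0⟩ := ((key'.filter_mono nhdsWithin_le_nhds).and
    (self_mem_nhdsWithin : {(0 : ℝ)}ᶜ ∈ nhdsWithin 0 {(0 : ℝ)}ᶜ)).exists
  exact ⟨_, h t ht0, fun z hz i hi => (ht i (Finset.mem_range_succ_iff.2 hi) z hz).le⟩

end CrClosure

/-! ### Polynomials as limits of shallow networks -/

section Ridge

variable {F : Type*} [NormedAddCommGroup F] [NormedSpace ℝ F]

/-- The span of the ridge functions `z ↦ σ (ℓ z + b)`. -/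
def ridge (σ : ℝ → ℝ) (F : Type*) [NormedAddCommGroup F] [NormedSpace ℝ F] :
    Submodule ℝ (F → ℝ) :=
  Submodule.span ℝ (Set.range fun p : (F →L[ℝ] ℝ) × ℝ => fun z => σ (p.1 z + p.2))

/-- Polynomial functions on a normed space. -/
def polyFun (F : Type*) [NormedAddCommGroup F] [NormedSpace ℝ F] : Subalgebra ℝ (F → ℝ) :=
  Algebra.adjoin ℝ (Set.range fun ℓ : F →L[ℝ] ℝ => ⇑ℓ)

theorem exists_polynomial_of_iteratedDeriv_eq_zero (n : ℕ) : ∀ {f : ℝ → ℝ}, ContDiff ℝ ∞ f →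
    (∀ t, iteratedDeriv n f t = 0) → ∃ p : ℝ[X], ∀ t, f t = p.eval t := by
  induction n with
  | zero => intro f _ h; exact ⟨0, fun t => by simpa using h t⟩
  | succ n ih =>
    intro f hf h
    obtain ⟨p, hp⟩ := ih (contDiff_infty_iff_deriv.1 hf).2 fun t => by
      rw [← iteratedDeriv_succ']; exact h t
    have hq : ∀ p : ℝ[X], ∃ q : ℝ[X], q.derivative = p := by
      intro p
      induction p using Polynomial.induction_on' with
      | add p₁ p₂ h₁ h₂ =>
        obtain ⟨q₁, rfl⟩ := h₁
        obtain ⟨q₂, rfl⟩ := h₂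
        exact ⟨q₁ + q₂, Polynomial.derivative_add⟩
      | monomial m a =>
        refine ⟨Polynomial.monomial (m + 1) (a / (m + 1)), ?_⟩
        rw [Polynomial.derivative_monomial]
        have : (m : ℝ) + 1 ≠ 0 := by positivity
        simp [this]
    obtain ⟨q, rfl⟩ := hq p
    refine ⟨q + Polynomial.C (f 0 - q.eval 0), fun t => ?_⟩
    have hd : Differentiable ℝ fun t => f t - q.eval t :=
      (contDiff_infty_iff_deriv.1 hf).1.sub q.differentiable
    have := is_const_of_deriv_eq_zero hd (fun t => by
      rw [deriv_fun_sub ((contDiff_infty_iff_deriv.1 hf).1 t) q.differentiableAt, hp t,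
        Polynomial.deriv, sub_self]) t 0
    simp only [Polynomial.eval_add, Polynomial.eval_C]
    linarith

/-- The point may depend on the order `n`; each monomial will use its own bias, so no common point
for all orders is needed. -/
theorem IsActivation.exists_iteratedDeriv_ne_zero {σ : ℝ → ℝ} (hσ : IsActivation σ) (n : ℕ) :
    ∃ b, iteratedDeriv n σ b ≠ 0 := by
  by_contra! h
  exact hσ.nonpolynomial (exists_polynomial_of_iteratedDeriv_eq_zero n hσ.smooth h)

theorem contDiff_list_prod (l : List (F →L[ℝ] ℝ)) :
    ContDiff ℝ ∞ fun z : F => (l.map fun v => v z).prod := by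
  induction l with
  | nil => simpa using contDiff_const
  | cons v l ih => simpa using v.contDiff.mul ih

theorem contDiff_of_mem_ridge {σ : ℝ → ℝ} (hσ : ContDiff ℝ ∞ σ) {f : F → ℝ} (hf : f ∈ ridge σ F) :
    ContDiff ℝ ∞ f := by
  induction hf using Submodule.span_induction with
  | mem _ h =>
    obtain ⟨p, rfl⟩ := h
    exact hσ.comp (p.1.contDiff.add contDiff_const)
  | zero => exact contDiff_const
  | add _ _ _ _ h₁ h₂ => exact h₁.add h₂
  | smul c _ _ h => exact contDiff_const.smul h

/-- Differentiating a ridge function with respect to its direction `w` along `v` brings out a factor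
`v z` and one more derivative of `σ`. Iterating produces all products of linear forms; `w` and `b`
stay general so that the induction can vary `w`. -/
theorem list_prod_mul_iteratedDeriv_mem_crClosure {σ : ℝ → ℝ} (hσ : ContDiff ℝ ∞ σ) (r : ℕ)
    {C : Set F} (hC : IsCompact C) (l : List (F →L[ℝ] ℝ)) : ∀ (w : F →L[ℝ] ℝ) (b : ℝ),
    (fun z => (l.map fun v => v z).prod * iteratedDeriv l.length σ (w z + b)) ∈
      crClosure r C (ridge σ F) := by
  induction l with
  | nil =>
    intro w b
    have h : (fun z => σ (w z + b)) ∈ ridge σ F := Submodule.subset_span ⟨(w, b), rfl⟩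
    simpa using mem_crClosure_of_mem (contDiff_of_mem_ridge hσ h) h
  | cons v l ih =>
    intro w b
    have hg : ContDiff ℝ ∞ (iteratedDeriv l.length σ) := by
      rw [iteratedDeriv_eq_iterate]; exact hσ.iterate_deriv _
    obtain ⟨ρ, hρ, hρ1, hρ0⟩ := exists_contDiff_hadamard hg
    -- For `t ≠ 0` this is the difference quotient between directions `w + t • v` and `w`; the
    -- Hadamard remainder extends it smoothly to the derivative at `t = 0`.
    let B : ℝ × F → ℝ := fun p => (l.map fun v => v p.2).prod * (v p.2 * ρ (w p.2 + b, p.1 * v p.2))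
    have hB : ContDiff ℝ ∞ B := by
      have h1 : ContDiff ℝ ∞ fun p : ℝ × F => v p.2 := v.contDiff.comp contDiff_snd
      have h2 : ContDiff ℝ ∞ fun p : ℝ × F => w p.2 := w.contDiff.comp contDiff_snd
      exact ((contDiff_list_prod l).comp contDiff_snd).mul (h1.mul (hρ.comp
        ((h2.add contDiff_const).prodMk (contDiff_fst.mul h1))))
    convert mem_crClosure_of_param (r := r) hC hB (S := ridge σ F) fun t ht => ?_ using 1
    · ext z
      simp only [B, List.map_cons, List.prod_cons, List.length_cons, zero_mul, hρ0,
        iteratedDeriv_succ]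
      ring
    · convert (crClosure r C (ridge σ F)).smul_mem t⁻¹
        ((crClosure r C (ridge σ F)).sub_mem (ih (w + t • v) b) (ih w b)) using 1
      ext z
      have := hρ1 (w z + b) (t * v z)
      have e : (w + t • v) z + b = w z + b + t * v z := by simp; ring
      simp only [B, Pi.smul_apply, Pi.sub_apply, smul_eq_mul, e, ← mul_sub, this]
      field_simp

/-- Polynomials are limits of shallow networks, together with all derivatives. -/
theorem polyFun_le_crClosure_ridge {σ : ℝ → ℝ} (hσ : IsActivation σ) (r : ℕ)
    {C : Set F} (hC : IsCompact C) {f : F → ℝ} (hf : f ∈ polyFun F) :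
    f ∈ crClosure r C (ridge σ F) := by
  have hf' : f ∈ Subalgebra.toSubmodule (polyFun F) := hf
  rw [polyFun, Algebra.adjoin_eq_span] at hf'
  refine Submodule.span_le.2 ?_ hf'
  intro g hg
  obtain ⟨l, hl, rfl⟩ := Submonoid.exists_list_of_mem_closure hg
  obtain ⟨L, rfl⟩ : ∃ L : List (F →L[ℝ] ℝ), L.map (fun ℓ : F →L[ℝ] ℝ => ⇑ℓ) = l := by
    clear hg hf' hf
    induction l with
    | nil => exact ⟨[], rfl⟩
    | cons a l ih =>
      obtain ⟨L, rfl⟩ := ih fun y hy => hl y (List.mem_cons_of_mem _ hy)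
      obtain ⟨ℓ, rfl⟩ := hl a List.mem_cons_self
      exact ⟨ℓ :: L, rfl⟩
  -- In direction `w = 0` the factor `iteratedDeriv L.length σ` is the constant at `b`; being
  -- nonzero it can be divided off.
  obtain ⟨b, hb⟩ := hσ.exists_iteratedDeriv_ne_zero L.length
  rw [SetLike.mem_coe]
  convert (crClosure r C (ridge σ F)).smul_mem (iteratedDeriv L.length σ b)⁻¹
    (list_prod_mul_iteratedDeriv_mem_crClosure hσ.smooth r hC L 0 b) using 1
  ext z
  have : (L.map fun ℓ : F →L[ℝ] ℝ => ⇑ℓ).prod z = (L.map fun v => v z).prod := by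
    clear hb hl hg
    induction L with
    | nil => rfl
    | cons a L ih => simp [ih]
  rw [this]
  simp
  field_simp

end Ridge

/-! ### Polynomial approximation by Landau kernels -/

section Landau

/-- All derivatives fall on `f`, so the kernel needs no smoothness; it will be a polynomial cut off
outside a ball. -/
theorem iteratedFDeriv_convolution_lsmul {X G : Type*} [NormedAddCommGroup X] [NormedSpace ℝ X]
    [FiniteDimensional ℝ X] [MeasurableSpace X] [BorelSpace X] {μ : Measure X} [μ.IsAddHaarMeasure]
    [NormedAddCommGroup G] [NormedSpace ℝ G] [CompleteSpace G] {s : ℕ} {φ : X → ℝ} {f : X → G}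
    (hφ : LocallyIntegrable φ μ) (hf : ContDiff ℝ s f) (hc : HasCompactSupport f) {i : ℕ}
    (hi : i ≤ s) (x : X) :
    iteratedFDeriv ℝ i (convolution φ f (ContinuousLinearMap.lsmul ℝ ℝ) μ) x =
      ∫ t, φ t • iteratedFDeriv ℝ i f (x - t) ∂μ := by
  induction i generalizing x with
  | zero =>
    rw [iteratedFDeriv_zero_eq_comp, Function.comp_apply, convolution_def]
    refine ((continuousMultilinearCurryFin0 ℝ X
      G).symm.toContinuousLinearEquiv.integral_comp_comm _).symm.trans ?_
    refine integral_congr_ae (Filter.Eventually.of_forall fun t => ?_)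
    simp [iteratedFDeriv_zero_eq_comp]
  | succ i ih =>
    have hg : ContDiff ℝ 1 (iteratedFDeriv ℝ i f) :=
      hf.iteratedFDeriv_right (m := 1) (by norm_cast; omega)
    have hgc : HasCompactSupport (iteratedFDeriv ℝ i f) := hc.iteratedFDeriv i
    have e : iteratedFDeriv ℝ i (convolution φ f (ContinuousLinearMap.lsmul ℝ ℝ) μ) =
        convolution φ (iteratedFDeriv ℝ i f) (ContinuousLinearMap.lsmul ℝ ℝ) μ := by
      ext1 x; rw [ih (by omega) x]; rfl
    rw [iteratedFDeriv_succ_eq_comp_left, Function.comp_apply, e,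
      (hgc.hasFDerivAt_convolution_right _ hφ hg x).fderiv, convolution_def]
    refine (ContinuousLinearEquiv.integral_comp_comm (X := X) (μ := μ) (𝕜 := ℝ) (E := X →L[ℝ] X [×i]→L[ℝ] G)
      (F := X [×(i + 1)]→L[ℝ] G) (continuousMultilinearCurryLeftEquiv ℝ (fun _ : Fin (i + 1) => X)
      G).symm.toContinuousLinearEquiv _).symm.trans ?_
    refine integral_congr_ae (Filter.Eventually.of_forall fun t => ?_)
    rw [iteratedFDeriv_succ_eq_comp_left]
    exact map_smul (continuousMultilinearCurryLeftEquiv ℝ (fun _ : Fin (i + 1) => X) G).symm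
      (φ t) (fderiv ℝ (iteratedFDeriv ℝ i f) (x - t))

theorem boundedContinuousFunction_integral_apply {X Y G : Type*} [TopologicalSpace X]
    [MeasurableSpace Y] {μ : Measure Y} [NormedAddCommGroup G] [NormedSpace ℝ G] [CompleteSpace G]
    {f : Y → BoundedContinuousFunction X G} (hf : Integrable f μ) (x : X) :
    (∫ y, f y ∂μ) x = ∫ y, f y x ∂μ :=
  ((BoundedContinuousFunction.evalCLM ℝ x).integral_comp_comm hf).symm

/-- Since `(x - y) i = x i - y i`, multiplying `P` by a variable gives `x i` times the old integral
minus the integral with weight `y i * g y`. Hence the induction must be uniform in `g`. -/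
theorem integral_eval_sub_mul_mem_polyFun {d : ℕ} (P : MvPolynomial (Fin d) ℝ) :
    ∀ {g : E d → ℝ}, Continuous g → HasCompactSupport g →
      (fun x : E d => ∫ y, MvPolynomial.eval (fun i => (x - y) i) P * g y) ∈ polyFun (E d) := by
  have hcont : ∀ (P : MvPolynomial (Fin d) ℝ) (x : E d),
      Continuous fun y : E d => MvPolynomial.eval (fun i => (x - y) i) P := fun P x =>
    (MvPolynomial.continuous_eval P).comp (by fun_prop)
  have h_int : ∀ (P : MvPolynomial (Fin d) ℝ) (x : E d) {g : E d → ℝ}, Continuous g →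
      HasCompactSupport g →
      Integrable fun y : E d => MvPolynomial.eval (fun i => (x - y) i) P * g y :=
    fun P x g hg hgc => ((hcont P x).mul hg).integrable_of_hasCompactSupport hgc.mul_left
  induction P using MvPolynomial.induction_on with
  | C a =>
    intro g hg hgc
    simp only [MvPolynomial.eval_C]
    exact (polyFun (E d)).algebraMap_mem (∫ y, a * g y)
  | add p q hp hq =>
    intro g hg hgc
    convert (polyFun (E d)).add_mem (hp hg hgc) (hq hg hgc) using 1
    ext x
    simp only [map_add, add_mul, Pi.add_apply]
    exact integral_add (h_int p x hg hgc) (h_int q x hg hgc)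
  | mul_X p i hp =>
    intro g hg hgc
    have hg1 : Continuous fun y : E d => y i * g y := by fun_prop
    have hg2 : HasCompactSupport fun y : E d => y i * g y := hgc.mul_left
    have hX : (fun x : E d => x i) ∈ polyFun (E d) :=
      Algebra.subset_adjoin ⟨EuclideanSpace.proj i, rfl⟩
    convert (polyFun (E d)).sub_mem ((polyFun (E d)).mul_mem hX (hp hg hgc)) (hp hg1 hg2) using 1
    ext x
    simp only [Pi.sub_apply, Pi.mul_apply]
    rw [← integral_const_mul, ← integral_sub ((h_int p x hg hgc).const_mul _) (h_int p x hg1 hg2)]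
    congr 1
    ext y
    simp
    ring

/-- The normalized powers of `1 - ‖z‖² / (4ρ²)` on the ball of radius `2ρ` concentrate at `0`. For
`x` and `y` in the ball of radius `ρ` the difference stays in the larger ball, so near `C` the
cutoff is invisible and the convolution is a polynomial. -/
theorem exists_polyFun_approx {d k s : ℕ} {f : E d → E k} (hf : ContDiff ℝ s f)
    (hc : HasCompactSupport f) {C : Set (E d)} (hC : Bornology.IsBounded C) {ε : ℝ} (hε : 0 < ε) :
    ∃ q : E d → E k, (∀ l, (fun x => q x l) ∈ polyFun (E d)) ∧
      ∀ x ∈ C, ∀ i ≤ s, ‖iteratedFDeriv ℝ i (q - f) x‖ ≤ ε := by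
  obtain ⟨ρ, hρ, hCρ, hfρ⟩ : ∃ ρ > 0, C ⊆ Metric.ball 0 ρ ∧ tsupport f ⊆ Metric.ball 0 ρ := by
    obtain ⟨ρ, hρ⟩ := (hC.union hc.isCompact.isBounded).subset_ball_lt 0 0
    exact ⟨ρ, hρ.1, Set.subset_union_left.trans hρ.2, Set.subset_union_right.trans hρ.2⟩
  let P : MvPolynomial (Fin d) ℝ :=
    1 - MvPolynomial.C ((4 * ρ ^ 2)⁻¹) * ∑ i, MvPolynomial.X i ^ 2
  let c : E d → ℝ := fun z => MvPolynomial.eval (fun i => z i) P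
  have hcz : ∀ z, c z = 1 - (4 * ρ ^ 2)⁻¹ * ‖z‖ ^ 2 := fun z => by
    simp [c, P, EuclideanSpace.norm_sq_eq]
  have hcc : Continuous c := (MvPolynomial.continuous_eval P).comp (by fun_prop)
  let B : Set (E d) := Metric.closedBall 0 (2 * ρ)
  have hB : IsCompact B := isCompact_closedBall 0 (2 * ρ)
  let I : ℕ → ℝ := fun n => ∫ z in B, c z ^ n
  let φ : ℕ → E d → ℝ := fun n => B.indicator fun z => c z ^ n
  have hφ : ∀ n, LocallyIntegrable (φ n) := fun n =>
    (((hcc.pow n).continuousOn.integrableOn_compact hB).integrable_indicator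
      hB.measurableSet).locallyIntegrable
  let h : ℕ → E d → E k := fun n =>
    (I n)⁻¹ • convolution (φ n) f (ContinuousLinearMap.lsmul ℝ ℝ) volume
  have hhs : ∀ n, ContDiff ℝ s (h n) := fun n =>
    contDiff_const.smul (hc.contDiff_convolution_right (n := s) _ (hφ n) hf)
  have hD : ∀ n i, i ≤ s → ∀ x, iteratedFDeriv ℝ i (h n) x =
      (I n)⁻¹ • ∫ z in B, c z ^ n • iteratedFDeriv ℝ i f (x - z) := by
    intro n i hi x
    rw [iteratedFDeriv_const_smul_apply ((hc.contDiff_convolution_right (n := s) _ (hφ n)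
      hf).contDiffAt.of_le (mod_cast hi)), iteratedFDeriv_convolution_lsmul (hφ n) hf hc hi,
      ← integral_indicator hB.measurableSet]
    congr 2
    ext1 z
    by_cases hz : z ∈ B <;> simp [φ, hz]
  have hconv : ∀ i ≤ s, ∀ᶠ n in Filter.atTop, ∀ x, ‖iteratedFDeriv ℝ i (h n - f) x‖ ≤ ε := by
    intro i hi
    have hgi : Continuous (iteratedFDeriv ℝ i f) := hf.continuous_iteratedFDeriv (mod_cast hi)
    have hgu : UniformContinuous (iteratedFDeriv ℝ i f) :=
      (hc.iteratedFDeriv i).uniformContinuous_of_continuous hgi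
    obtain ⟨M, hM⟩ := hgi.bounded_above_of_compact_support (hc.iteratedFDeriv i)
    -- Treating the translate by `z` as one vector in a space with the sup norm makes the
    -- peak-kernel limit uniform in `x`.
    let g : E d → BoundedContinuousFunction (E d) (E d [×i]→L[ℝ] E k) := fun z =>
      BoundedContinuousFunction.ofNormedAddCommGroup (fun x => iteratedFDeriv ℝ i f (x - z))
        (by fun_prop) M fun x => hM _
    have hgc : Continuous g := by
      refine Metric.continuous_iff.2 fun z δ hδ => ?_
      obtain ⟨η, hη, H⟩ := Metric.uniformContinuous_iff.1 hgu (δ / 2) (half_pos hδ)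
      refine ⟨η, hη, fun y hy => lt_of_le_of_lt ?_ (half_lt_self hδ)⟩
      refine (BoundedContinuousFunction.dist_le (half_pos hδ).le).2 fun x => (H ?_).le
      rwa [dist_sub_left]
    have key := tendsto_setIntegral_pow_smul_of_unique_maximum_of_isCompact_of_continuousOn
      (μ := (volume : Measure (E d))) (x₀ := 0) (g := g) hB (c := c) hcc.continuousOn
      (fun y _ hy => by
        rw [hcz, hcz]
        have : 0 < (4 * ρ ^ 2)⁻¹ * ‖y‖ ^ 2 := by
          have := norm_pos_iff.2 hy
          positivity
        simpa using this)
      (fun y hy => by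
        have hy' : ‖y‖ ≤ 2 * ρ := by simpa [B] using hy
        rw [hcz, sub_nonneg, inv_mul_le_iff₀ (by positivity)]
        nlinarith [norm_nonneg y])
      (by rw [hcz]; simp)
      (subset_closure (by
        rw [mem_interior_iff_mem_nhds]
        exact Metric.closedBall_mem_nhds 0 (by positivity)))
      hgc.continuousOn
    filter_upwards [Metric.tendsto_nhds.1 key ε hε] with n hn x
    rw [iteratedFDeriv_sub_apply ((hhs n).contDiffAt.of_le (mod_cast hi))
      (hf.contDiffAt.of_le (mod_cast hi)), hD n i hi]
    have hev := ((BoundedContinuousFunction.dist_coe_le_dist x).trans_lt hn).le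
    have h_int : (∫ z in B, c z ^ n • g z) x = ∫ z in B, c z ^ n • iteratedFDeriv ℝ i f (x - z) := by
      exact boundedContinuousFunction_integral_apply
        (((hcc.pow n).smul hgc).continuousOn.integrableOn_compact hB) x
    rw [dist_eq_norm, BoundedContinuousFunction.smul_apply, h_int] at hev
    simpa [g] using hev
  obtain ⟨n, hn⟩ := ((Finset.eventually_all (Finset.range (s + 1))).2 fun i hi =>
    hconv i (Finset.mem_range_succ_iff.1 hi)).exists
  let q : E d → E k := fun x => WithLp.toLp 2 fun l =>
    (I n)⁻¹ * ∫ y, MvPolynomial.eval (fun i => (x - y) i) (P ^ n) * f y l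
  have hqh : Set.EqOn q (h n) (Metric.ball 0 ρ) := by
    intro x hx
    ext l
    have hfl : Continuous fun y => f y l := by
      have := hf.continuous; fun_prop
    have h1 : h n x = (I n)⁻¹ • ∫ t, φ n t • f (x - t) := rfl
    have h2 : ∀ y, φ n (x - y) • f y = c (x - y) ^ n • f y := by
      intro y
      by_cases hy : y ∈ tsupport f
      · have : x - y ∈ B := by
          have hx' : ‖x‖ < ρ := by simpa using hx
          have hy' : ‖y‖ < ρ := by simpa using hfρ hy
          simp only [B, mem_closedBall_zero_iff]
          linarith [norm_sub_le x y]
        simp [φ, this]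
      · simp [image_eq_zero_of_notMem_tsupport hy]
    have h3 : ∫ t, φ n t • f (x - t) = ∫ y, c (x - y) ^ n • f y := by
      rw [← integral_sub_left_eq_self _ volume x]
      simp only [sub_sub_cancel, h2]
    have h_int : Integrable fun y => c (x - y) ^ n • f y :=
      (((hcc.comp (continuous_const.sub continuous_id)).pow n).smul hf.continuous).integrable_of_hasCompactSupport hc.smul_left
    have h4 := (EuclideanSpace.proj (𝕜 := ℝ) l).integral_comp_comm h_int
    rw [h1, h3]
    simp only [q, PiLp.smul_apply, smul_eq_mul]
    congr 1
    refine Eq.trans ?_ h4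
    simp [c]
  refine ⟨q, fun l => ?_, fun x hx i hi => ?_⟩
  · have hfl : Continuous fun y => f y l := by
      have := hf.continuous; fun_prop
    have hfc : HasCompactSupport fun y => f y l :=
      hc.comp_left (g := fun v : E k => v l) rfl
    exact (polyFun (E d)).smul_mem (integral_eval_sub_mul_mem_polyFun (P ^ n) hfl hfc) (I n)⁻¹
  · have : q - f =ᶠ[nhds x] h n - f := by
      filter_upwards [Metric.isOpen_ball.mem_nhds (hCρ hx)] with y hy
      simp [hqh hy]
    rw [(this.iteratedFDeriv ℝ i).eq_of_nhds]
    exact hn i (Finset.mem_range_succ_iff.2 hi) x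

end Landau

/-! ### Extension beyond the boundary by inward translation -/

section Density

/-- Near every point of its closure, a Lipschitz domain is mapped into itself by small translations
in a suitable direction. -/
theorem IsBoundedLipschitzDomain.exists_inward {d : ℕ} {Ω : Set (E d)}
    (hΩ : IsBoundedLipschitzDomain Ω) {x₀ : E d} (hx₀ : x₀ ∈ closure Ω) :
    ∃ r > 0, ∃ e : E d, ∀ y ∈ closure Ω, dist y x₀ < r → ∀ t, 0 < t → t < r → y + t • e ∈ Ω := by
  by_cases hx : x₀ ∈ Ω
  · obtain ⟨r, hr, hb⟩ := Metric.isOpen_iff.1 hΩ.isOpen x₀ hx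
    exact ⟨r, hr, 0, fun y _ hy t _ _ => by simpa using hb hy⟩
  · have hf : x₀ ∈ frontier Ω := ⟨hx₀, fun h => hx (interior_subset h)⟩
    obtain ⟨V, hVo, hxV, e, he, L, γ, hγ, hV⟩ := hΩ.lipschitz x₀ hf
    obtain ⟨r, hr, hb⟩ := Metric.isOpen_iff.1 hVo x₀ hxV
    refine ⟨r / 2, half_pos hr, e, fun y hy hyx t ht htr => ?_⟩
    have hyV : y ∈ V := hb (lt_trans hyx (half_lt_self hr))
    have hytV : y + t • e ∈ V := by
      refine hb ?_
      rw [Metric.mem_ball]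
      calc dist (y + t • e) x₀ ≤ dist (y + t • e) y + dist y x₀ := dist_triangle _ _ _
        _ = t + dist y x₀ := by simp [dist_eq_norm, norm_smul, he, abs_of_pos ht]
        _ < r := by linarith
    -- Points of the closure satisfy the graph inequality weakly; adding `t • e` keeps the
    -- projection and raises the `e`-coordinate by `t`, which makes it strict.
    have hle : γ ((ℝ ∙ e)ᗮ.orthogonalProjectionOnto y) ≤ inner ℝ e y := by
      have hcl : y ∈ closure (Ω ∩ V) := by
        rw [Set.inter_comm]; exact hVo.inter_closure ⟨hyV, hy⟩
      have hclosed : IsClosed {z : E d | γ ((ℝ ∙ e)ᗮ.orthogonalProjectionOnto z) ≤ inner ℝ e z} :=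
        isClosed_le (hγ.continuous.comp (ContinuousLinearMap.continuous _)) (by fun_prop)
      exact closure_minimal (fun z hz => ((hV z hz.2).1 hz.1).le) hclosed hcl
    rw [hV _ hytV, map_add, map_smul,
      Submodule.orthogonalProjectionOnto_orthogonal_apply_eq_zero
        (Submodule.mem_span_singleton_self e), smul_zero, add_zero, inner_add_right,
      inner_smul_right, real_inner_self_eq_norm_sq, he]
    linarith

theorem norm_le_sum_norm_apply_single {d m : ℕ} {G : Type*} [NormedAddCommGroup G]
    [NormedSpace ℝ G] (M : E d [×m]→L[ℝ] G) :
    ‖M‖ ≤ ∑ f : Fin m → Fin d, ‖M fun j => EuclideanSpace.single (f j) (1 : ℝ)‖ := by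
  refine M.opNorm_le_bound (by positivity) fun v => ?_
  have hv : v = fun j => ∑ i, v j i • EuclideanSpace.single i (1 : ℝ) := by
    ext j l
    simp [Finset.sum_apply, Pi.single_apply]
  have h1 : M v = ∑ f : Fin m → Fin d,
      (∏ j, v j (f j)) • M fun j => EuclideanSpace.single (f j) (1 : ℝ) := by
    conv_lhs => rw [hv]
    rw [M.map_sum]
    exact Finset.sum_congr rfl fun f _ => M.map_smul_univ _ _
  rw [h1, Finset.sum_mul]
  refine (norm_sum_le _ _).trans (Finset.sum_le_sum fun f _ => ?_)
  rw [norm_smul, mul_comm, norm_prod]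
  gcongr with j
  exact PiLp.norm_apply_le _ _

/-- Each coordinate derivative extends continuously to the compact closure, hence is uniformly
continuous, and finitely many of them control the full derivative. -/
theorem uniformContinuous_iteratedFDeriv_of_cBar {d k s : ℕ} {Ω : TopologicalSpace.Opens (E d)}
    (hΩ : IsCompact (closure (Ω : Set (E d)))) (u : CBar d k s Ω) {U : E d → E k}
    (hu : ∀ (I : Dirs d s) (x : E d) (hx : x ∈ (Ω : Set (E d))),
      u.1 I ⟨x, subset_closure hx⟩ = partialD I U x) {m : ℕ} (hm : m ≤ s) {ε : ℝ} (hε : 0 < ε) :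
    ∃ δ > 0, ∀ x ∈ Ω, ∀ y ∈ Ω, dist x y < δ →
      ‖iteratedFDeriv ℝ m U x - iteratedFDeriv ℝ m U y‖ ≤ ε := by
  have : CompactSpace (closure (Ω : Set (E d))) := isCompact_iff_compactSpace.1 hΩ
  let N : ℝ := Fintype.card (Fin m → Fin d)
  have hN : 0 ≤ N := Nat.cast_nonneg _
  have key : ∀ f : Fin m → Fin d, ∀ᶠ δ in nhdsWithin (0 : ℝ) (Set.Ioi 0), ∀ x ∈ Ω, ∀ y ∈ Ω,
      dist x y < δ → ‖(iteratedFDeriv ℝ m U x - iteratedFDeriv ℝ m U y)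
        fun j => EuclideanSpace.single (f j) (1 : ℝ)‖ ≤ ε / (N + 1) := by
    intro f
    let I : Dirs d s := ⟨⟨m, Nat.lt_succ_of_le hm⟩, f⟩
    obtain ⟨δ, hδ, H⟩ := Metric.uniformContinuous_iff.1
      (CompactSpace.uniformContinuous_of_continuous (u.1 I).continuous) (ε / (N + 1))
      (by positivity)
    filter_upwards [Ioo_mem_nhdsGT hδ] with δ' hδ' x hx y hy hxy
    have := (H (a := ⟨x, subset_closure hx⟩) (b := ⟨y, subset_closure hy⟩)
      (lt_trans hxy hδ'.2)).le
    rw [hu I x hx, hu I y hy, dist_eq_norm] at this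
    exact this
  obtain ⟨δ, hδ, hδ0⟩ := ((Filter.eventually_all.2 key).and
    (self_mem_nhdsWithin : Set.Ioi (0 : ℝ) ∈ nhdsWithin (0 : ℝ) (Set.Ioi 0))).exists
  refine ⟨δ, hδ0, fun x hx y hy hxy => (norm_le_sum_norm_apply_single _).trans ?_⟩
  calc _ ≤ ∑ _f : Fin m → Fin d, ε / (N + 1) :=
        Finset.sum_le_sum fun f _ => hδ f x hx y hy hxy
    _ = N * (ε / (N + 1)) := by simp [N]
    _ ≤ ε := by
        rw [mul_div_assoc', div_le_iff₀ (by positivity)]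
        nlinarith

/-- By the Leibniz rule, bounded derivatives of `χ` meet differences of translated derivatives of
`U`, which are small by uniform continuity. Off `tsupport χ` the product vanishes locally, so only
there must the translate stay in Ω. -/
theorem eventually_norm_iteratedFDeriv_smul_translate_le {d k s : ℕ} {Ω : Set (E d)}
    (hΩo : IsOpen Ω) (hΩ : IsCompact (closure Ω)) {U : E d → E k} (hU : ContDiffOn ℝ s U Ω)
    (huc : ∀ m ≤ s, ∀ ε > 0, ∃ δ > 0, ∀ x ∈ Ω, ∀ y ∈ Ω, dist x y < δ →
      ‖iteratedFDeriv ℝ m U x - iteratedFDeriv ℝ m U y‖ ≤ ε)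
    {χ : E d → ℝ} (hχ : ContDiff ℝ ∞ χ) {e : E d} {r : ℝ} (hr : 0 < r)
    (he : ∀ x ∈ Ω, x ∈ tsupport χ → ∀ t, 0 < t → t < r → x + t • e ∈ Ω) {m : ℕ} (hm : m ≤ s)
    {ε : ℝ} (hε : 0 < ε) :
    ∀ᶠ t in nhdsWithin (0 : ℝ) (Set.Ioi 0), ∀ x ∈ Ω,
      ‖iteratedFDeriv ℝ m (fun y => χ y • (U (y + t • e) - U y)) x‖ ≤ ε := by
  have hA : ∃ A > 0, ∀ x ∈ Ω, ∀ j ≤ m, ‖iteratedFDeriv ℝ j χ x‖ ≤ A := by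
    have : ∀ j : ℕ, ∃ A, ∀ x ∈ closure Ω, ‖iteratedFDeriv ℝ j χ x‖ ≤ A := fun j =>
      hΩ.exists_bound_of_continuousOn
        (hχ.continuous_iteratedFDeriv (m := j) (mod_cast le_top)).continuousOn
    choose A hA using this
    refine ⟨1 + ∑ j ∈ Finset.range (m + 1), |A j|, by positivity, fun x hx j hj => ?_⟩
    have h1 := hA j x (subset_closure hx)
    have h2 := Finset.single_le_sum (f := fun j => |A j|) (fun _ _ => abs_nonneg _)
      (Finset.mem_range_succ_iff.2 hj)
    have h3 := le_abs_self (A j)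
    linarith
  obtain ⟨A, hA0, hA⟩ := hA
  -- The binomial coefficients in the Leibniz sum add up to `2 ^ m`.
  have hη : 0 < ε / (2 ^ m * A) := by positivity
  have hδ : ∀ j ∈ Finset.range (m + 1), ∀ᶠ t in nhdsWithin (0 : ℝ) (Set.Ioi 0),
      ∀ x ∈ Ω, x + t • e ∈ Ω →
        ‖iteratedFDeriv ℝ j U (x + t • e) - iteratedFDeriv ℝ j U x‖ ≤ ε / (2 ^ m * A) := by
    intro j hj
    obtain ⟨δ, hδ, H⟩ := huc j ((Finset.mem_range_succ_iff.1 hj).trans hm) _ hη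
    have hlim : Filter.Tendsto (fun t : ℝ => ‖t • e‖) (nhdsWithin (0 : ℝ) (Set.Ioi 0)) (nhds 0) := by
      have : Continuous fun t : ℝ => ‖t • e‖ := by fun_prop
      simpa using (this.tendsto 0).mono_left nhdsWithin_le_nhds
    filter_upwards [hlim.eventually_lt_const hδ] with t ht x hx hxt
    refine H _ hxt _ hx ?_
    simpa [dist_eq_norm] using ht
  filter_upwards [(Finset.eventually_all _).2 hδ, Ioo_mem_nhdsGT hr] with t ht htr x hx
  by_cases hxs : x ∈ tsupport χ
  · let O : Set (E d) := Ω ∩ (fun y => y + t • e) ⁻¹' Ω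
    have hO : IsOpen O := hΩo.inter (hΩo.preimage (by fun_prop))
    have hxO : x ∈ O := ⟨hx, he x hx hxs t htr.1 htr.2⟩
    have h1 : ContDiffOn ℝ s (fun y => U (y + t • e)) O :=
      hU.comp (contDiff_id.add contDiff_const).contDiffOn fun y hy => hy.2
    have h2 : ContDiffOn ℝ s U O := hU.mono Set.inter_subset_left
    have hle := norm_iteratedFDerivWithin_smul_le (n := m) (N := (s : WithTop ℕ∞))
      (f := χ) (g := fun y => U (y + t • e) - U y) (hχ.of_le (mod_cast le_top)).contDiffOn
      (h1.sub h2) hO.uniqueDiffOn hxO (mod_cast hm)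
    rw [iteratedFDerivWithin_of_isOpen m hO hxO] at hle
    refine hle.trans ?_
    calc _ ≤ ∑ j ∈ Finset.range (m + 1), (m.choose j : ℝ) * A * (ε / (2 ^ m * A)) := by
          refine Finset.sum_le_sum fun j hj => ?_
          have hj' := Finset.mem_range_succ_iff.1 hj
          rw [iteratedFDerivWithin_of_isOpen j hO hxO,
            iteratedFDerivWithin_of_isOpen (m - j) hO hxO]
          have hmj : ((m - j : ℕ) : WithTop ℕ∞) ≤ s := mod_cast (Nat.sub_le m j).trans hm
          have e1 : iteratedFDeriv ℝ (m - j) (fun y => U (y + t • e) - U y) x =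
              iteratedFDeriv ℝ (m - j) U (x + t • e) - iteratedFDeriv ℝ (m - j) U x := by
            rw [← iteratedFDeriv_comp_add_right]
            exact iteratedFDeriv_sub_apply ((h1.contDiffAt (hO.mem_nhds hxO)).of_le hmj)
              ((h2.contDiffAt (hO.mem_nhds hxO)).of_le hmj)
          rw [e1]
          gcongr
          · exact hA x hx j hj'
          · exact ht (m - j) (Finset.mem_range_succ_iff.2 (Nat.sub_le m j)) x hx hxO.2
      _ = ε := by
          rw [← Finset.sum_mul, ← Finset.sum_mul]
          have := Nat.sum_range_choose m
          have h' : ∑ j ∈ Finset.range (m + 1), (m.choose j : ℝ) = 2 ^ m := by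
            exact_mod_cast this
          rw [h']
          field_simp
  · have : (fun y => χ y • (U (y + t • e) - U y)) =ᶠ[nhds x] fun _ => 0 := by
      filter_upwards [(isClosed_tsupport χ).isOpen_compl.mem_nhds hxs] with y hy
      rw [image_eq_zero_of_notMem_tsupport hy, zero_smul]
    rw [(this.iteratedFDeriv ℝ m).eq_of_nhds]
    simpa using hε.le

theorem exists_contDiff_eqOn_nhds {d k s : ℕ} {C : Set (E d)} (hC : IsCompact C) {f : E d → E k}
    (hf : ∀ x ∈ C, ContDiffAt ℝ s f x) :
    ∃ g : E d → E k, ContDiff ℝ s g ∧ HasCompactSupport g ∧ ∀ x ∈ C, g =ᶠ[nhds x] f := by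
  let O : Set (E d) := interior {x | ContDiffAt ℝ s f x}
  have hCO : C ⊆ O := fun x hx => mem_interior_iff_mem_nhds.2 ((hf x hx).eventually (by simp))
  obtain ⟨T, hT, hCT, hTO⟩ := exists_compact_between hC isOpen_interior hCO
  obtain ⟨θ, hθ1, hθ0, -⟩ := exists_contMDiffMap_one_nhds_of_subset_interior
    (modelWithCornersSelf ℝ (E d)) (n := ⊤) hC.isClosed hCT
  have hθ : ContDiff ℝ s θ := (contMDiff_iff_contDiff.1 θ.contMDiff).of_le (mod_cast le_top)
  refine ⟨fun x => θ x • f x, contDiff_iff_contDiffAt.2 fun x => ?_, ?_, fun x hx => ?_⟩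
  · by_cases hx : x ∈ T
    · exact hθ.contDiffAt.smul (interior_subset (hTO hx) : ContDiffAt ℝ s f x)
    · have : (fun x => θ x • f x) =ᶠ[nhds x] fun _ => 0 := by
        filter_upwards [hT.isClosed.isOpen_compl.mem_nhds hx] with y hy
        rw [hθ0 y hy, zero_smul]
      exact contDiffAt_const.congr_of_eventuallyEq this
  · exact HasCompactSupport.intro hT fun x hx => by rw [hθ0 x hx, zero_smul]
  · filter_upwards [hθ1.filter_mono (nhds_le_nhdsSet hx)] with y hy
    rw [hy, one_smul]

/-- Functions in `C^s(Ω̄)` can be approximated by restrictions of compactly supported functions. -/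
theorem exists_contDiff_approx {d k s : ℕ} {Ω : TopologicalSpace.Opens (E d)}
    (hΩ : IsBoundedLipschitzDomain (Ω : Set (E d))) {U : E d → E k}
    (hU : ContDiffOn ℝ s U (Ω : Set (E d)))
    (huc : ∀ m ≤ s, ∀ ε > 0, ∃ δ > 0, ∀ x ∈ Ω, ∀ y ∈ Ω, dist x y < δ →
      ‖iteratedFDeriv ℝ m U x - iteratedFDeriv ℝ m U y‖ ≤ ε) {ε : ℝ} (hε : 0 < ε) :
    ∃ f : E d → E k, ContDiff ℝ s f ∧ HasCompactSupport f ∧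
      ∀ x ∈ Ω, ∀ m ≤ s, ‖iteratedFDeriv ℝ m (f - U) x‖ ≤ ε := by
  choose! r hr e he using fun x₀ (hx : x₀ ∈ closure (Ω : Set (E d))) => hΩ.exists_inward hx
  obtain ⟨T, hTcl, hT⟩ := hΩ.isCompact_closure.elim_nhds_subcover (fun x => Metric.ball x (r x))
    fun x hx => Metric.ball_mem_nhds x (hr x hx)
  obtain ⟨χ, hχ⟩ := SmoothPartitionOfUnity.exists_isSubordinate (modelWithCornersSelf ℝ (E d))
    (isClosed_closure (s := (Ω : Set (E d)))) (fun i : T => Metric.ball i.1 (r i.1))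
    (fun _ => Metric.isOpen_ball) (by rwa [Set.iUnion_subtype])
  have hχs : ∀ i, ContDiff ℝ ∞ (χ i) := fun i => contMDiff_iff_contDiff.1 (χ i).contMDiff
  have hχ1 : ∀ x ∈ closure (Ω : Set (E d)), ∑ i, χ i x = 1 := fun x hx => by
    rw [← finsum_eq_sum_of_fintype]; exact χ.sum_eq_one hx
  have hin : ∀ (i : T), ∀ x ∈ closure (Ω : Set (E d)), x ∈ tsupport (χ i) →
      ∀ t, 0 < t → t < r i.1 → x + t • e i.1 ∈ (Ω : Set (E d)) := fun i x hx hxi =>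
    he i.1 (hTcl i.1 i.2) x hx (hχ i hxi)
  let N : ℝ := Fintype.card T
  have hN : 0 ≤ N := Nat.cast_nonneg _
  have h1 : ∀ i : T, ∀ᶠ t in nhdsWithin (0 : ℝ) (Set.Ioi 0), ∀ m ∈ Finset.range (s + 1), ∀ x ∈ Ω,
      ‖iteratedFDeriv ℝ m (fun y => χ i y • (U (y + t • e i.1) - U y)) x‖ ≤ ε / (N + 1) :=
    fun i => (Finset.eventually_all _).2 fun m hm =>
      eventually_norm_iteratedFDeriv_smul_translate_le Ω.isOpen hΩ.isCompact_closure hU huc (hχs i)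
        (hr i.1 (hTcl i.1 i.2)) (fun x hx => hin i x (subset_closure hx))
        (Finset.mem_range_succ_iff.1 hm) (by positivity)
  have h2 : ∀ i : T, ∀ᶠ t in nhdsWithin (0 : ℝ) (Set.Ioi 0), t ∈ Set.Ioo 0 (r i.1) := fun i =>
    Ioo_mem_nhdsGT (hr i.1 (hTcl i.1 i.2))
  obtain ⟨t, ht, htr⟩ := ((Filter.eventually_all.2 h1).and (Filter.eventually_all.2 h2)).exists
  -- The translation carries the part of the closure inside `tsupport (χ i)` into Ω, where `U` is
  -- smooth. So each term is smooth even at boundary points.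
  have hterm : ∀ i, ∀ x ∈ closure (Ω : Set (E d)),
      ContDiffAt ℝ s (fun y => χ i y • U (y + t • e i.1)) x := by
    intro i x hx
    by_cases hxs : x ∈ tsupport (χ i)
    · have hmem := hin i x hx hxs t (htr i).1 (htr i).2
      refine ((hχs i).contDiffAt.of_le (mod_cast le_top)).smul ?_
      exact ContDiffAt.comp (g := U) x (hU.contDiffAt (Ω.isOpen.mem_nhds hmem))
        (contDiffAt_id.add contDiffAt_const)
    · have : (fun y => χ i y • U (y + t • e i.1)) =ᶠ[nhds x] fun _ => 0 := by
        filter_upwards [(isClosed_tsupport (χ i)).isOpen_compl.mem_nhds hxs] with y hy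
        rw [image_eq_zero_of_notMem_tsupport hy, zero_smul]
      exact contDiffAt_const.congr_of_eventuallyEq this
  obtain ⟨g, hg, hgc, hgeq⟩ := exists_contDiff_eqOn_nhds hΩ.isCompact_closure
    (f := fun y => ∑ i, χ i y • U (y + t • e i.1))
    fun x hx => ContDiffAt.sum fun i _ => hterm i x hx
  refine ⟨g, hg, hgc, fun x hx m hm => ?_⟩
  have heq : g - U =ᶠ[nhds x] fun y => ∑ i, χ i y • (U (y + t • e i.1) - U y) := by
    filter_upwards [hgeq x (subset_closure hx), Ω.isOpen.mem_nhds hx] with y hy hyΩ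
    simp only [smul_sub, Finset.sum_sub_distrib, Pi.sub_apply, hy, ← Finset.sum_smul,
      hχ1 y (subset_closure hyΩ), one_smul]
  have hms : (m : WithTop ℕ∞) ≤ s := mod_cast hm
  have hdiff : ∀ i, ContDiffAt ℝ m (fun y => χ i y • (U (y + t • e i.1) - U y)) x := fun i => by
    simp only [smul_sub]
    exact ((hterm i x (subset_closure hx)).sub (((hχs i).contDiffAt.of_le (mod_cast le_top)).smul
      (hU.contDiffAt (Ω.isOpen.mem_nhds hx)))).of_le hms
  rw [(heq.iteratedFDeriv ℝ m).eq_of_nhds, iteratedFDeriv_fun_sum_apply fun i _ => hdiff i]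
  calc _ ≤ ∑ _i : T, ε / (N + 1) := norm_sum_le_of_le _ fun i _ =>
        ht i m (Finset.mem_range_succ_iff.2 hm) x hx
    _ = N * (ε / (N + 1)) := by simp [N]
    _ ≤ ε := by
        rw [mul_div_assoc', div_le_iff₀ (by positivity)]
        nlinarith

end Density

/-! ### Polynomials in $C^s(\overline\Omega)$ -/

section CBarApprox

variable {d k s : ℕ} {Ω : TopologicalSpace.Opens (E d)}

theorem norm_partialD_le (I : Dirs d s) (f : E d → E k) (x : E d) :
    ‖partialD I f x‖ ≤ ‖iteratedFDeriv ℝ I.1.val f x‖ := by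
  refine (ContinuousMultilinearMap.le_opNorm _ _).trans ?_
  simp

theorem continuous_partialD (I : Dirs d s) {f : E d → E k} (hf : ContDiff ℝ s f) :
    Continuous (partialD I f) := by
  have h : ((I.1.val : ℕ) : WithTop ℕ∞) ≤ s := by exact_mod_cast Nat.lt_succ_iff.1 I.1.2
  exact (ContinuousMultilinearMap.apply ℝ _ _ _).continuous.comp (hf.continuous_iteratedFDeriv h)

theorem partialD_apply (I : Dirs d s) {f : E d → E k} {x : E d} (hf : ContDiffAt ℝ s f x)
    (l : Fin k) : partialD I f x l = iteratedFDeriv ℝ I.1.val (fun y => f y l) x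
      fun j => EuclideanSpace.single (I.2 j) (1 : ℝ) := by
  have h : ((I.1.val : ℕ) : WithTop ℕ∞) ≤ s := by exact_mod_cast Nat.lt_succ_iff.1 I.1.2
  have := (EuclideanSpace.proj (𝕜 := ℝ) l).iteratedFDeriv_comp_left hf h
  exact (DFunLike.congr_fun this _).symm

theorem norm_le_sum_abs (v : E k) : ‖v‖ ≤ ∑ l, |v l| := by
  have h : v = ∑ l, v l • EuclideanSpace.single l (1 : ℝ) := by
    ext j
    simp [Finset.sum_apply, Pi.single_apply]
  calc ‖v‖ = ‖∑ l, v l • EuclideanSpace.single l (1 : ℝ)‖ := by rw [← h]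
    _ ≤ ∑ l, ‖v l • EuclideanSpace.single l (1 : ℝ)‖ := norm_sum_le _ _
    _ = ∑ l, |v l| := by simp [norm_smul]

/-- The element of `C^s(Ω̄)` given by a `C^s` function on the whole space. -/
noncomputable def CBar.ofContDiff (hΩ : IsCompact (closure (Ω : Set (E d)))) (f : E d → E k)
    (hf : ContDiff ℝ s f) : CBar d k s Ω :=
  ⟨fun I => haveI := isCompact_iff_compactSpace.1 hΩ
    BoundedContinuousFunction.mkOfCompact ⟨fun x => partialD I f x.1,
      (continuous_partialD I hf).comp continuous_subtype_val⟩,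
    f, hf.contDiffOn, fun _ _ _ => rfl⟩

theorem CBar.ofContDiff_fn (hΩ : IsCompact (closure (Ω : Set (E d)))) {f : E d → E k}
    (hf : ContDiff ℝ s f) (x : closure (Ω : Set (E d))) :
    (CBar.ofContDiff hΩ f hf).fn x = f x.1 := partialD_nil (s := s) f x.1

theorem CBar.norm_le {u : CBar d k s Ω} {C : ℝ} (hC : 0 ≤ C)
    (h : ∀ (I : Dirs d s) (x : E d) (hx : x ∈ Ω), ‖u.1 I ⟨x, subset_closure hx⟩‖ ≤ C) :
    ‖u‖ ≤ C := by
  refine (pi_norm_le_iff_of_nonneg hC).2 fun I => (BoundedContinuousFunction.norm_le hC).2 ?_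
  have hd : DenseRange (Set.inclusion (subset_closure (s := (Ω : Set (E d))))) :=
    (denseRange_inclusion_iff subset_closure).2 subset_rfl
  exact fun x => hd.induction_on (p := fun x => ‖u.1 I x‖ ≤ C) x
    (isClosed_le (u.1 I).continuous.norm continuous_const) fun y => h I y.1 y.2

theorem contDiff_of_mem_polyFun {F : Type*} [NormedAddCommGroup F] [NormedSpace ℝ F] {f : F → ℝ}
    (hf : f ∈ polyFun F) : ContDiff ℝ ∞ f := by
  induction hf using Algebra.adjoin_induction with
  | mem _ h =>
    obtain ⟨ℓ, rfl⟩ := h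
    exact ℓ.contDiff
  | algebraMap c => exact contDiff_const
  | add _ _ _ _ h₁ h₂ => exact h₁.add h₂
  | mul _ _ _ _ h₁ h₂ => exact h₁.mul h₂

theorem comp_mem_polyFun {F G : Type*} [NormedAddCommGroup F] [NormedSpace ℝ F]
    [NormedAddCommGroup G] [NormedSpace ℝ G] {f : F → ℝ} (hf : f ∈ polyFun F) (L : G →L[ℝ] F) :
    (fun z => f (L z)) ∈ polyFun G := by
  induction hf using Algebra.adjoin_induction with
  | mem _ h =>
    obtain ⟨ℓ, rfl⟩ := h
    exact Algebra.subset_adjoin ⟨ℓ.comp L, rfl⟩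
  | algebraMap c => exact (polyFun G).algebraMap_mem c
  | add _ _ _ _ h₁ h₂ => exact add_mem h₁ h₂
  | mul _ _ _ _ h₁ h₂ => exact mul_mem h₁ h₂

theorem contDiff_of_forall_mem_polyFun {n : ℕ} {q : E d → E k}
    (hq : ∀ l, (fun x => q x l) ∈ polyFun (E d)) : ContDiff ℝ n q :=
  contDiff_euclidean.2 fun l => (contDiff_of_mem_polyFun (hq l)).of_le (mod_cast le_top)

/-- Polynomials are dense in `C^s(Ω̄)`. -/
theorem CBar.exists_polyFun_approx (hΩ : IsBoundedLipschitzDomain (Ω : Set (E d)))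
    (u : CBar d k s Ω) {ε : ℝ} (hε : 0 < ε) :
    ∃ (q : E d → E k) (hq : ∀ l, (fun x => q x l) ∈ polyFun (E d)),
      ‖u - CBar.ofContDiff hΩ.isCompact_closure q (contDiff_of_forall_mem_polyFun hq)‖ ≤ ε := by
  obtain ⟨U, hU, hu⟩ := u.2
  obtain ⟨f, hf, hfc, hfU⟩ := exists_contDiff_approx hΩ hU (fun m hm ε hε =>
    uniformContinuous_iteratedFDeriv_of_cBar hΩ.isCompact_closure u hu hm hε) (half_pos hε)
  obtain ⟨q, hq, hqf⟩ := ANO.exists_polyFun_approx hf hfc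
    (hΩ.isCompact_closure.isBounded) (half_pos hε)
  refine ⟨q, hq, CBar.norm_le hε.le fun I x hx => ?_⟩
  have hqs : ContDiff ℝ s q := contDiff_of_forall_mem_polyFun hq
  have hm : I.1.val ≤ s := Nat.lt_succ_iff.1 I.1.2
  have hUx : ContDiffAt ℝ s U x := hU.contDiffAt (Ω.isOpen.mem_nhds hx)
  have e1 : (u - CBar.ofContDiff hΩ.isCompact_closure q hqs).1 I ⟨x, subset_closure hx⟩ =
      -(partialD I (q - f) x + partialD I (f - U) x) := by
    have h1 : partialD I (q - f) x = partialD I q x - partialD I f x := by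
      simp only [partialD]
      rw [iteratedFDeriv_sub_apply (hqs.contDiffAt.of_le (mod_cast hm))
        (hf.contDiffAt.of_le (mod_cast hm))]
      rfl
    have h2 : partialD I (f - U) x = partialD I f x - partialD I U x := by
      simp only [partialD]
      rw [iteratedFDeriv_sub_apply (hf.contDiffAt.of_le (mod_cast hm))
        (hUx.of_le (mod_cast hm))]
      rfl
    rw [h1, h2, ← hu I x hx]
    change u.1 I _ - partialD I q x = _
    abel
  rw [e1, norm_neg]
  calc _ ≤ ‖partialD I (q - f) x‖ + ‖partialD I (f - U) x‖ := norm_add_le _ _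
    _ ≤ ε / 2 + ε / 2 := add_le_add
        ((norm_partialD_le _ _ _).trans (hqf x (subset_closure hx) _ hm))
        ((norm_partialD_le _ _ _).trans (hfU x hx _ hm))
    _ = ε := add_halves ε

end CBarApprox

/-! ### Finite-rank approximation -/

section FiniteRank

/-- Continuous maps on a compact space are limits of maps of finite rank. -/
theorem exists_finite_rank_approx {X G : Type*} [TopologicalSpace X] [CompactSpace X] [T2Space X]
    [NormedAddCommGroup G] [NormedSpace ℝ G] {F : X → G} (hF : Continuous F) {ε : ℝ} (hε : 0 < ε) :
    ∃ (T : Finset X) (α : T → C(X, ℝ)), (∀ i x, 0 ≤ α i x) ∧ (∀ x, ∑ i, α i x = 1) ∧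
      ∀ x, ‖F x - ∑ i, α i x • F i.1‖ ≤ ε := by
  obtain ⟨T, -, hT⟩ := (isCompact_univ (X := X)).elim_nhds_subcover
    (fun x => F ⁻¹' Metric.ball (F x) ε)
    fun x _ => hF.continuousAt.preimage_mem_nhds (Metric.ball_mem_nhds _ hε)
  obtain ⟨α, hα⟩ := PartitionOfUnity.exists_isSubordinate (isClosed_univ (X := X))
    (fun i : T => F ⁻¹' Metric.ball (F i.1) ε) (fun i => Metric.isOpen_ball.preimage hF)
    (by rwa [Set.iUnion_subtype])
  have hα1 : ∀ x, ∑ i, α i x = 1 := fun x => by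
    rw [← finsum_eq_sum_of_fintype]; exact α.sum_eq_one (Set.mem_univ x)
  refine ⟨T, fun i => α i, fun i x => α.nonneg i x, hα1, fun x => ?_⟩
  have e1 : F x - ∑ i, α i x • F i.1 = ∑ i, α i x • (F x - F i.1) := by
    simp only [smul_sub, Finset.sum_sub_distrib, ← Finset.sum_smul, hα1, one_smul]
  rw [e1]
  calc _ ≤ ∑ i, α i x * ε := norm_sum_le_of_le _ fun i _ => by
        rw [norm_smul, Real.norm_of_nonneg (α.nonneg i x)]
        by_cases hx : x ∈ tsupport (α i)
        · have := hα i hx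
          rw [Set.mem_preimage, mem_ball_iff_norm] at this
          exact mul_le_mul_of_nonneg_left this.le (α.nonneg i x)
        · rw [image_eq_zero_of_notMem_tsupport hx, zero_mul, zero_mul]
    _ = ε := by rw [← Finset.sum_mul, hα1, one_mul]

end FiniteRank

/-! ### Averaged features and separation of points -/

section Features

variable {d k s : ℕ} {Ω : TopologicalSpace.Opens (E d)}

/-- Lebesgue measure on an open set, as a measure on the subtype. -/
noncomputable abbrev volOn (Ω : TopologicalSpace.Opens (E d)) : Measure ↥(Ω : Set (E d)) :=
  Measure.comap Subtype.val volume

/-- The average over `Ω` of `R (u y, y)`. -/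
noncomputable def avg (Ω : TopologicalSpace.Opens (E d)) (R : E k × E d → ℝ)
    (u : closure (Ω : Set (E d)) → E k) : ℝ :=
  ⨍ y, R (u (Set.inclusion subset_closure y), y.1) ∂(volOn Ω)

theorem isFiniteMeasure_volOn (hΩ : IsCompact (closure (Ω : Set (E d)))) :
    IsFiniteMeasure (volOn Ω) := by
  refine ⟨?_⟩
  rw [(MeasurableEmbedding.subtype_coe Ω.isOpen.measurableSet).comap_apply]
  exact (measure_mono (by simpa using subset_closure)).trans_lt hΩ.measure_lt_top

theorem isOpenPosMeasure_volOn : (volOn Ω).IsOpenPosMeasure := by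
  refine ⟨fun A hA hne => ?_⟩
  rw [(MeasurableEmbedding.subtype_coe Ω.isOpen.measurableSet).comap_apply]
  exact ((Ω.isOpen.isOpenMap_subtype_val A hA).measure_pos _ (hne.image _)).ne'

theorem avg_const_mul (c : ℝ) (R : E k × E d → ℝ) (u : closure (Ω : Set (E d)) → E k) :
    avg Ω (c • R) u = c * avg Ω R u := by
  simp only [avg, average_eq, Pi.smul_apply, smul_eq_mul, integral_const_mul]
  ring

theorem continuous_fn (u : CBar d k s Ω) : Continuous u.fn := (u.1 _).continuous

theorem continuous_uncurry_fn :
    Continuous fun p : CBar d k s Ω × closure (Ω : Set (E d)) => p.1.fn p.2 := by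
  have h : Continuous fun p : CBar d k s Ω × closure (Ω : Set (E d)) =>
      (p.1.1 (Dirs.nil d s), p.2) :=
    (((continuous_apply _).comp continuous_subtype_val).comp continuous_fst).prodMk continuous_snd
  exact continuous_eval.comp h

theorem continuous_avg (hΩ : IsCompact (closure (Ω : Set (E d)))) {K : Set (CBar d k s Ω)}
    (hK : IsCompact K) {R : E k × E d → ℝ} (hR : Continuous R) :
    Continuous fun u : K => avg Ω R u.1.fn := by
  have := isCompact_iff_compactSpace.1 hΩ
  have := isCompact_iff_compactSpace.1 hK
  have := isFiniteMeasure_volOn hΩ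
  have hpair : Continuous fun p : K × closure (Ω : Set (E d)) => (p.1.1, p.2) :=
    (continuous_subtype_val.comp continuous_fst).prodMk continuous_snd
  have hc : Continuous fun p : K × closure (Ω : Set (E d)) => R (p.1.1.fn p.2, p.2.1) :=
    hR.comp ((continuous_uncurry_fn.comp hpair).prodMk
      (continuous_subtype_val.comp continuous_snd))
  obtain ⟨M, hM⟩ := isCompact_univ.exists_bound_of_continuousOn hc.continuousOn
  simp only [avg, average_eq]
  suffices h : Continuous fun u : K => ∫ y : ↥(Ω : Set (E d)),
      R (u.1.fn (Set.inclusion subset_closure y), y.1) ∂(volOn Ω) from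
    h.const_smul ((volOn Ω).real Set.univ)⁻¹
  refine continuous_of_dominated (bound := fun _ => M)
    (fun u => ?_) (fun u => ?_) (integrable_const M) ?_
  · have hu : Continuous fun y : ↥(Ω : Set (E d)) =>
        (u, Set.inclusion (subset_closure (s := (Ω : Set (E d)))) y) :=
      continuous_const.prodMk (continuous_inclusion subset_closure)
    exact (hc.comp hu).aestronglyMeasurable
  · exact Filter.Eventually.of_forall fun y => hM (u, _) (Set.mem_univ _)
  · exact Filter.Eventually.of_forall fun y => hc.comp (continuous_id.prodMk continuous_const)

theorem integrable_comp_inclusion (hΩ : IsCompact (closure (Ω : Set (E d))))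
    {g : closure (Ω : Set (E d)) → ℝ} (hg : Continuous g) :
    Integrable (fun y => g (Set.inclusion subset_closure y)) (volOn Ω) := by
  have := isCompact_iff_compactSpace.1 hΩ
  have := isFiniteMeasure_volOn hΩ
  obtain ⟨M, hM⟩ := isCompact_univ.exists_bound_of_continuousOn hg.continuousOn
  exact Integrable.of_bound (hg.comp (continuous_inclusion subset_closure)).aestronglyMeasurable M
    (Filter.Eventually.of_forall fun y => hM _ (Set.mem_univ _))

theorem exists_polyFun_near (hΩ : IsCompact (closure (Ω : Set (E d))))
    {f : closure (Ω : Set (E d)) → ℝ} (hf : Continuous f) {ε : ℝ} (hε : 0 < ε) :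
    ∃ q ∈ polyFun (E d), ∀ x, ‖f x - q x.1‖ ≤ ε := by
  have := isCompact_iff_compactSpace.1 hΩ
  let A : Subalgebra ℝ C(closure (Ω : Set (E d)), ℝ) := Algebra.adjoin ℝ
    (Set.range fun ℓ : E d →L[ℝ] ℝ => ⟨fun x => ℓ x.1, by fun_prop⟩)
  have hA : ∀ g ∈ A, ∃ q ∈ polyFun (E d), ∀ x, g x = q x.1 := by
    intro g hg
    induction hg using Algebra.adjoin_induction with
    | mem _ h =>
      obtain ⟨ℓ, rfl⟩ := h
      exact ⟨ℓ, Algebra.subset_adjoin ⟨ℓ, rfl⟩, fun x => rfl⟩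
    | algebraMap c => exact ⟨_, (polyFun (E d)).algebraMap_mem c, fun x => rfl⟩
    | add _ _ _ _ h₁ h₂ =>
      obtain ⟨q₁, hq₁, e₁⟩ := h₁
      obtain ⟨q₂, hq₂, e₂⟩ := h₂
      exact ⟨_, add_mem hq₁ hq₂, fun x => by simp [e₁, e₂]⟩
    | mul _ _ _ _ h₁ h₂ =>
      obtain ⟨q₁, hq₁, e₁⟩ := h₁
      obtain ⟨q₂, hq₂, e₂⟩ := h₂
      exact ⟨_, mul_mem hq₁ hq₂, fun x => by simp [e₁, e₂]⟩
  have hsep : A.SeparatesPoints := by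
    intro x y hxy
    obtain ⟨i, hi⟩ : ∃ i, x.1 i ≠ y.1 i := by
      by_contra! h
      exact hxy (Subtype.ext (PiLp.ext h))
    exact ⟨_, ⟨_, Algebra.subset_adjoin ⟨EuclideanSpace.proj i, rfl⟩, rfl⟩, hi⟩
  obtain ⟨⟨g, hgA⟩, hg⟩ := ContinuousMap.exists_mem_subalgebra_near_continuous_of_separatesPoints
    A hsep f hf ε hε
  obtain ⟨q, hq, e⟩ := hA g hgA
  refine ⟨q, hq, fun x => ?_⟩
  rw [norm_sub_rev, ← e]
  exact (hg x).le

/-- Orthogonality gives `∫ f² = ∫ f (f - q)` for every polynomial `q`, and `q` can be taken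
uniformly close to `f`. Thus `f` vanishes on Ω, and on the closure by density. -/
theorem eq_of_integral_sub_mul_polyFun_eq_zero (hΩ : IsCompact (closure (Ω : Set (E d))))
    {f : closure (Ω : Set (E d)) → ℝ} (hf : Continuous f)
    (h : ∀ q ∈ polyFun (E d), ∫ y, f (Set.inclusion subset_closure y) * q y.1 ∂(volOn Ω) = 0) :
    f = 0 := by
  have := isCompact_iff_compactSpace.1 hΩ
  have := isFiniteMeasure_volOn hΩ
  have := isOpenPosMeasure_volOn (Ω := Ω)
  let ι : ↥(Ω : Set (E d)) → closure (Ω : Set (E d)) := Set.inclusion subset_closure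
  have hι : Continuous ι := continuous_inclusion subset_closure
  obtain ⟨M, hM⟩ := isCompact_univ.exists_bound_of_continuousOn hf.continuousOn
  have hff : Integrable (fun y => f (ι y) * f (ι y)) (volOn Ω) :=
    integrable_comp_inclusion hΩ (hf.mul hf)
  have hsq : ∫ y, f (ι y) * f (ι y) ∂(volOn Ω) = 0 := by
    refine norm_le_zero_iff.1 (le_of_forall_pos_le_add fun ε hε => ?_)
    let V := (volOn Ω).real Set.univ
    have hV : 0 ≤ V := measureReal_nonneg
    obtain ⟨q, hq, hqf⟩ := exists_polyFun_near hΩ hf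
      (show 0 < ε / ((|M| + 1) * (V + 1)) by positivity)
    have hfq : Integrable (fun y => f (ι y) * q y.1) (volOn Ω) := integrable_comp_inclusion hΩ
      (hf.mul ((contDiff_of_mem_polyFun hq).continuous.comp continuous_subtype_val))
    have h1 : ∫ y, f (ι y) * f (ι y) ∂(volOn Ω) =
        ∫ y, f (ι y) * (f (ι y) - q y.1) ∂(volOn Ω) := by
      simp only [mul_sub]
      rw [integral_sub hff hfq, h q hq, sub_zero]
    rw [h1, zero_add]
    calc _ ≤ ((|M| + 1) * (ε / ((|M| + 1) * (V + 1)))) * V := by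
          refine norm_integral_le_of_norm_le_const (Filter.Eventually.of_forall fun y => ?_)
          rw [norm_mul]
          gcongr
          · have h3 := hM (ι y) (Set.mem_univ _)
            have h4 := le_abs_self M
            linarith
          · exact hqf (ι y)
      _ = ε * (V / (V + 1)) := by field_simp
      _ ≤ ε := mul_le_of_le_one_right hε.le ((div_le_one (by positivity)).2 (by linarith))
  have hae : (fun y => f (ι y) * f (ι y)) =ᵐ[volOn Ω] 0 :=
    (integral_eq_zero_iff_of_nonneg (fun y => mul_self_nonneg _) hff).1 hsq
  have hffc : Continuous fun y => f (ι y) * f (ι y) := (hf.comp hι).mul (hf.comp hι)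
  have hz : (fun y => f (ι y) * f (ι y)) = 0 :=
    (hffc.ae_eq_iff_eq _ continuous_const).1 hae
  have hd : DenseRange ι := (denseRange_inclusion_iff subset_closure).2 subset_rfl
  refine hd.equalizer hf continuous_const (funext fun y => ?_)
  exact mul_self_eq_zero.1 (congrFun hz y)

theorem exists_ridge_avg_ne {σ : ℝ → ℝ} (hσ : IsActivation σ)
    (hΩ : IsCompact (closure (Ω : Set (E d)))) {u v : CBar d k s Ω} (huv : u ≠ v) :
    ∃ R ∈ ridge σ (E k × E d), avg Ω R u.fn ≠ avg Ω R v.fn := by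
  by_contra! hR
  refine huv (CBar.ext_fn (funext fun x₀ => ?_))
  have := isCompact_iff_compactSpace.1 hΩ
  have := isFiniteMeasure_volOn hΩ
  have := isOpenPosMeasure_volOn (Ω := Ω)
  let ι : ↥(Ω : Set (E d)) → closure (Ω : Set (E d)) := Set.inclusion subset_closure
  have hne : Nonempty ↥(Ω : Set (E d)) := by
    rw [Set.nonempty_coe_sort, ← closure_nonempty_iff]; exact ⟨x₀.1, x₀.2⟩
  let V := (volOn Ω).real Set.univ
  have hV : 0 < V := by
    have : (volOn Ω) Set.univ ≠ 0 := isOpen_univ.measure_ne_zero _ Set.univ_nonempty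
    exact ENNReal.toReal_pos this (measure_ne_top _ _)
  have hIR : ∀ R ∈ ridge σ (E k × E d),
      ∫ y, R (u.fn (ι y), y.1) ∂(volOn Ω) = ∫ y, R (v.fn (ι y), y.1) ∂(volOn Ω) := by
    intro R hRm
    have := hR R hRm
    simp only [avg, average_eq, smul_eq_mul] at this
    exact mul_left_cancel₀ (inv_ne_zero hV.ne') this
  have hcurve : ∀ w : CBar d k s Ω, Continuous fun x : closure (Ω : Set (E d)) => (w.fn x, x.1) :=
    fun w => (continuous_fn w).prodMk continuous_subtype_val
  have hIP : ∀ P ∈ polyFun (E k × E d),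
      ∫ y, P (u.fn (ι y), y.1) ∂(volOn Ω) = ∫ y, P (v.fn (ι y), y.1) ∂(volOn Ω) := by
    intro P hP
    have hC : ∀ w : CBar d k s Ω,
        IsCompact (Set.range fun x : closure (Ω : Set (E d)) => (w.fn x, x.1)) := fun w =>
      isCompact_range (hcurve w)
    -- Uniform approximation (order `0`) suffices for integrals; the compact set contains the graphs
    -- of both `u` and `v`.
    obtain ⟨hPs, H⟩ := polyFun_le_crClosure_ridge hσ 0 ((hC u).union (hC v)) hP
    refine sub_eq_zero.1 (norm_le_zero_iff.1 (le_of_forall_pos_le_add fun ε hε => ?_))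
    obtain ⟨N, hN, hNs, hb⟩ := H (ε / (2 * V)) (by positivity)
    have hw : ∀ w : CBar d k s Ω, (∀ x, (w.fn x, x.1) ∈
        (Set.range fun x : closure (Ω : Set (E d)) => (u.fn x, x.1)) ∪
        (Set.range fun x : closure (Ω : Set (E d)) => (v.fn x, x.1))) →
        ‖∫ y, P (w.fn (ι y), y.1) ∂(volOn Ω) - ∫ y, N (w.fn (ι y), y.1) ∂(volOn Ω)‖ ≤ ε / 2 := by
      intro w hw
      have hPi : Integrable (fun y => P (w.fn (ι y), y.1)) (volOn Ω) :=
        integrable_comp_inclusion hΩ (hPs.continuous.comp (hcurve w))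
      have hNi : Integrable (fun y => N (w.fn (ι y), y.1)) (volOn Ω) :=
        integrable_comp_inclusion hΩ (hNs.continuous.comp (hcurve w))
      rw [← integral_sub hPi hNi]
      calc _ ≤ ε / (2 * V) * V := norm_integral_le_of_norm_le_const
            (Filter.Eventually.of_forall fun y => by
              simpa using hb _ (hw (ι y)) 0 le_rfl)
        _ = ε / 2 := by field_simp
    have h1 := hw u fun x => Or.inl ⟨x, rfl⟩
    have h2 := hw v fun x => Or.inr ⟨x, rfl⟩
    rw [hIR N hN] at h1
    rw [norm_sub_rev] at h2
    rw [zero_add]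
    calc _ ≤ _ := norm_sub_le_norm_sub_add_norm_sub _ (∫ y, N (v.fn (ι y), y.1) ∂(volOn Ω)) _
      _ ≤ ε := by linarith
  ext i
  have hci : ∀ w : CBar d k s Ω, Continuous fun x => w.fn x i := fun w =>
    (EuclideanSpace.proj (𝕜 := ℝ) i).continuous.comp (continuous_fn w)
  have hz := eq_of_integral_sub_mul_polyFun_eq_zero hΩ (f := fun x => u.fn x i - v.fn x i)
    ((hci u).sub (hci v)) fun q hq => ?_
  · exact sub_eq_zero.1 (congrFun hz x₀)
  · have hqP : (fun p : E k × E d => p.1 i * q p.2) ∈ polyFun (E k × E d) := by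
      refine mul_mem (Algebra.subset_adjoin
        ⟨(EuclideanSpace.proj i).comp (ContinuousLinearMap.fst ℝ (E k) (E d)), rfl⟩) ?_
      exact comp_mem_polyFun hq (ContinuousLinearMap.snd ℝ (E k) (E d))
    have hqc : Continuous q := (contDiff_of_mem_polyFun hq).continuous
    have := hIP _ hqP
    have hi : ∀ w : CBar d k s Ω, Integrable (fun y => w.fn (ι y) i * q y.1) (volOn Ω) := fun w =>
      integrable_comp_inclusion hΩ ((hci w).mul (hqc.comp continuous_subtype_val))
    simp only [sub_mul]
    rw [integral_sub (hi u) (hi v)]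
    exact sub_eq_zero.2 this

/-- The functions `u ↦ σ (b + ⨍ R (u y, y))`, with `R` a shallow network. -/
noncomputable def feature {σ : ℝ → ℝ} (hσ : IsActivation σ)
    (hΩ : IsCompact (closure (Ω : Set (E d)))) {K : Set (CBar d k s Ω)} (hK : IsCompact K)
    (p : ridge σ (E k × E d) × ℝ) : C(K, ℝ) where
  toFun u := σ (p.2 + avg Ω p.1.1 u.1.fn)
  continuous_toFun := hσ.smooth.continuous.comp (continuous_const.add
    (continuous_avg hΩ hK (contDiff_of_mem_ridge hσ.smooth p.1.2).continuous))

/-- Some network has different averages at `u` and `v`. Rescaling it by `t` and shifting by `b`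
moves the two arguments of `σ` to any prescribed pair of distinct reals, so failure to separate
would make `σ` constant. -/
theorem separatesPoints_feature {σ : ℝ → ℝ} (hσ : IsActivation σ)
    (hΩ : IsCompact (closure (Ω : Set (E d)))) {K : Set (CBar d k s Ω)} (hK : IsCompact K) :
    (Algebra.adjoin ℝ (Set.range (feature hσ hΩ hK))).SeparatesPoints := by
  intro u v huv
  obtain ⟨R, hR, hne⟩ := exists_ridge_avg_ne hσ hΩ (fun h => huv (Subtype.ext h) : u.1 ≠ v.1)
  by_contra! hcon
  have key : ∀ t b : ℝ, σ (b + t * avg Ω R u.1.fn) = σ (b + t * avg Ω R v.1.fn) := by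
    intro t b
    have := hcon (feature hσ hΩ hK (⟨t • R, Submodule.smul_mem _ t hR⟩, b))
      ⟨_, Algebra.subset_adjoin ⟨_, rfl⟩, rfl⟩
    simpa [feature, avg_const_mul] using this
  refine hσ.nonpolynomial ⟨Polynomial.C (σ 0), fun x => ?_⟩
  have h1 : avg Ω R u.1.fn - avg Ω R v.1.fn ≠ 0 := sub_ne_zero.2 hne
  -- This scale and shift send the average at `u` to `x` and the average at `v` to `0`.
  have := key (x / (avg Ω R u.1.fn - avg Ω R v.1.fn))
    (-(x / (avg Ω R u.1.fn - avg Ω R v.1.fn)) * avg Ω R v.1.fn)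
  rw [Polynomial.eval_C]
  convert this using 2
  · field_simp; ring
  · ring

/-- Every continuous function on `K` is approximated by polynomials in features. -/
theorem exists_mvPolynomial_feature_approx {σ : ℝ → ℝ} (hσ : IsActivation σ)
    (hΩ : IsCompact (closure (Ω : Set (E d)))) {K : Set (CBar d k s Ω)} (hK : IsCompact K)
    (α : C(K, ℝ)) {ε : ℝ} (hε : 0 < ε) :
    ∃ p : MvPolynomial (ridge σ (E k × E d) × ℝ) ℝ, ∀ u : K,
      |MvPolynomial.eval (fun i => feature hσ hΩ hK i u) p - α u| ≤ ε := by
  have := isCompact_iff_compactSpace.1 hK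
  obtain ⟨⟨g, hg⟩, hgα⟩ := ContinuousMap.exists_mem_subalgebra_near_continuousMap_of_separatesPoints
    _ (separatesPoints_feature hσ hΩ hK) α ε hε
  rw [Algebra.adjoin_range_eq_range_aeval] at hg
  obtain ⟨p, rfl⟩ := hg
  refine ⟨p, fun u => ?_⟩
  have e : MvPolynomial.eval (fun i => feature hσ hΩ hK i u) p =
      (MvPolynomial.aeval (feature hσ hΩ hK) p) u := by
    have := MvPolynomial.comp_aeval_apply (ContinuousMap.evalAlgHom ℝ ℝ u) (f := feature hσ hΩ hK) p
    exact (this.trans rfl).symm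
  rw [e]
  exact ((ContinuousMap.norm_coe_le_norm (_ - α) u).trans_lt hgα).le

end Features

/-! ### Assembling the parameters of the operator -/

section Realization

/-- Finitely many elements of the span of ridge functions share a common finite set of ridges. -/
theorem exists_finset_of_mem_ridge {σ : ℝ → ℝ} {F : Type*} [NormedAddCommGroup F] [NormedSpace ℝ F]
    {ι : Type*} [Fintype ι] (N : ι → ridge σ F) :
    ∃ (S : Finset ((F →L[ℝ] ℝ) × ℝ)) (a : ι → (F →L[ℝ] ℝ) × ℝ → ℝ),
      ∀ l z, (N l).1 z = ∑ p : S, a l p.1 * σ (p.1.1 z + p.1.2) := by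
  classical
  choose a ha using fun l => Finsupp.mem_span_range_iff_exists_finsupp.1 (N l).2
  refine ⟨Finset.univ.biUnion fun l => (a l).support, fun l p => a l p, fun l z => ?_⟩
  rw [Finset.univ_eq_attach, Finset.sum_attach _ fun p => a l p * σ (p.1 z + p.2), ← ha l,
    Finsupp.sum_of_support_subset (a l) (Finset.subset_biUnion_of_mem (fun l => (a l).support)
      (Finset.mem_univ l)) (fun p c => c • fun z => σ (p.1 z + p.2)) (fun _ _ => zero_smul _ _)]
  simp [Finset.sum_apply]

theorem clm_euclidean_apply {d : ℕ} (L : E d →L[ℝ] ℝ) (x : E d) :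
    L x = ∑ j, L (EuclideanSpace.single j 1) * x j := by
  have hx : x = ∑ i, x i • EuclideanSpace.single i (1 : ℝ) := by
    ext j; simp [Finset.sum_apply, Pi.single_apply]
  conv_lhs => rw [hx]
  simp only [map_sum, map_smul, smul_eq_mul, mul_comm]

theorem clm_pi_apply {ι : Type*} [Fintype ι] [DecidableEq ι] (L : (ι → ℝ) →L[ℝ] ℝ) (v : ι → ℝ) :
    L v = ∑ i, L (Pi.single i 1) * v i := by
  have hv : v = ∑ i, v i • Pi.single i (1 : ℝ) := by
    ext j; simp [Finset.sum_apply, Pi.single_apply]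
  conv_lhs => rw [hv]
  simp only [map_sum, map_smul, smul_eq_mul, mul_comm]

theorem clm_prod_apply {F G : Type*} [NormedAddCommGroup F] [NormedSpace ℝ F]
    [NormedAddCommGroup G] [NormedSpace ℝ G] (L : F × G →L[ℝ] ℝ) (v : F) (x : G) :
    L (v, x) = (L.comp (ContinuousLinearMap.inl ℝ F G)) v +
      (L.comp (ContinuousLinearMap.inr ℝ F G)) x := by
  simp [← map_add]

/-- The averaging neural operator with zero weight matrix realizes every choice of features and of
an output network. -/
theorem exists_params {d k k' : ℕ} (Ω : TopologicalSpace.Opens (E d)) (σ : ℝ → ℝ) {ι : Type*}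
    [Fintype ι] (R : ι → ridge σ (E k × E d)) (b : ι → ℝ)
    (N : Fin k' → ridge σ ((ι → ℝ) × E d)) :
    ∃ (c : ℕ) (θ : Params d k k' c), ∀ (u : closure (Ω : Set (E d)) → E k)
      (x : closure (Ω : Set (E d))), θ.apply Ω σ u x =
        WithLp.toLp 2 fun l => (N l).1 (fun i => σ (b i + avg Ω (R i).1 u), x.1) := by
  classical
  obtain ⟨S, a, ha⟩ := exists_finset_of_mem_ridge R
  obtain ⟨S', a', ha'⟩ := exists_finset_of_mem_ridge N
  -- One channel dimension serves all layers: `S` indexes the hidden units of `R`, `ι` the features,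
  -- `S'` the hidden units of `Q`. Unused blocks are filled with zeros, and `QN.A₁` ignores the
  -- channels outside `ι`.
  let C := S ⊕ ι ⊕ S'
  let e : C ≃ Fin (Fintype.card C) := Fintype.equivFin C
  let RN : ShallowNet k d (Fintype.card C) (Fintype.card C) :=
    { A₁ := fun r j => Sum.elim
        (fun p : S => Sum.elim (fun i => p.1.1 (EuclideanSpace.single i 1, 0))
          (fun j => p.1.1 (0, EuclideanSpace.single j 1)) j) (fun _ => 0) (e.symm r)
      b₁ := fun r => Sum.elim (fun p : S => p.1.2) (fun _ => 0) (e.symm r)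
      A₂ := fun o r => Sum.elim (fun _ => 0)
        (Sum.elim (fun i => Sum.elim (fun p : S => a i p.1) (fun _ => 0) (e.symm r)) fun _ => 0)
        (e.symm o)
      b₂ := 0 }
  let QN : ShallowNet (Fintype.card C) d (Fintype.card C) k' :=
    { A₁ := fun r j => Sum.elim (fun _ => 0) (Sum.elim (fun _ => 0)
        fun p : S' => Sum.elim
          (fun q => Sum.elim (fun _ => 0) (Sum.elim (fun i => p.1.1 (Pi.single i 1, 0))
            fun _ => 0) (e.symm q))
          (fun j => p.1.1 (0, EuclideanSpace.single j 1)) j) (e.symm r)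
      b₁ := fun r => Sum.elim (fun _ => 0) (Sum.elim (fun _ => 0) fun p : S' => p.1.2) (e.symm r)
      A₂ := fun l r => Sum.elim (fun _ => 0) (Sum.elim (fun _ => 0)
        fun p : S' => a' l p.1) (e.symm r)
      b₂ := 0 }
  have hR : ∀ (i : ι) (v : E k) (x : E d),
      RN.eval σ v x (e (Sum.inr (Sum.inl i))) = (R i).1 (v, x) := by
    intro i v x
    rw [ha i]
    simp only [ShallowNet.eval, Pi.add_apply, Matrix.mulVec, dotProduct, RN]
    rw [← Equiv.sum_comp e]
    simp only [Equiv.symm_apply_apply, Fintype.sum_sum_type, C]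
    simp only [Sum.elim_inl, Sum.elim_inr, zero_mul, Finset.sum_const_zero,
      Pi.zero_apply, add_zero]
    refine Finset.sum_congr rfl fun p _ => ?_
    rw [clm_prod_apply, clm_euclidean_apply, clm_euclidean_apply]
    rfl
  have hQ : ∀ (w : E (Fintype.card C)) (x : E d) (l : Fin k'),
      QN.eval σ w x l = (N l).1 (fun i => w (e (Sum.inr (Sum.inl i))), x) := by
    intro w x l
    rw [ha' l]
    simp only [ShallowNet.eval, Pi.add_apply, Matrix.mulVec, dotProduct, QN]
    rw [← Equiv.sum_comp e]
    simp only [Equiv.symm_apply_apply, Fintype.sum_sum_type, C]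
    simp only [Sum.elim_inl, Sum.elim_inr, zero_mul, Finset.sum_const_zero, zero_add,
      Pi.zero_apply, add_zero]
    refine Finset.sum_congr rfl fun p _ => ?_
    rw [clm_prod_apply, clm_pi_apply, clm_euclidean_apply, ← Equiv.sum_comp e]
    simp [C, Fintype.sum_sum_type]
  refine ⟨Fintype.card C, ⟨RN, 0, fun r => Sum.elim (fun _ => 0) (Sum.elim b fun _ => 0) (e.symm r),
    QN⟩, fun u x => ?_⟩
  ext l
  simp only [Params.apply, hQ]
  refine congrArg (N l).1 (Prod.ext (funext fun i => ?_) rfl)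
  simp only [avgLayer, hR, Matrix.zero_mulVec, Pi.zero_apply, zero_add, Equiv.symm_apply_apply,
    Sum.elim_inr, Sum.elim_inl]
  rfl

end Realization

theorem eval_mem_polyFun {ι : Type*} [Fintype ι] {d : ℕ} (p : MvPolynomial ι ℝ) :
    (fun z : (ι → ℝ) × E d => MvPolynomial.eval z.1 p) ∈ polyFun ((ι → ℝ) × E d) := by
  induction p using MvPolynomial.induction_on with
  | C a => simp only [MvPolynomial.eval_C]; exact (polyFun ((ι → ℝ) × E d)).algebraMap_mem a
  | add p q hp hq => simp only [map_add]; exact add_mem hp hq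
  | mul_X p i hp =>
    simp only [map_mul, MvPolynomial.eval_X]
    exact mul_mem hp (Algebra.subset_adjoin
      ⟨(ContinuousLinearMap.proj i).comp (ContinuousLinearMap.fst ℝ (ι → ℝ) (E d)), rfl⟩)

/-! ### Norm comparisons in $C^s(\overline\Omega)$ and error bookkeeping -/

section Comparison

variable {d k s : ℕ} {Ω : TopologicalSpace.Opens (E d)}

theorem CBar.norm_ofContDiff_sub_le (hΩ : IsCompact (closure (Ω : Set (E d)))) {f g : E d → E k}
    (hf : ContDiff ℝ s f) (hg : ContDiff ℝ s g) {ε : ℝ} (hε : 0 ≤ ε)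
    (h : ∀ x ∈ Ω, ∀ l, ∀ m ≤ s, ‖iteratedFDeriv ℝ m (fun y => f y l - g y l) x‖ ≤ ε) :
    ‖CBar.ofContDiff hΩ f hf - CBar.ofContDiff hΩ g hg‖ ≤ k * ε := by
  refine CBar.norm_le (by positivity) fun I x hx => ?_
  change ‖partialD I f x - partialD I g x‖ ≤ _
  have hm : I.1.val ≤ s := Nat.lt_succ_iff.1 I.1.2
  have hcomp : ∀ {f : E d → E k}, ContDiff ℝ s f → ∀ l, ContDiffAt ℝ I.1.val (fun y => f y l) x :=
    fun hf l => ((contDiff_euclidean.1 hf l).contDiffAt).of_le (mod_cast hm)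
  refine (norm_le_sum_abs _).trans ?_
  calc _ ≤ ∑ _l : Fin k, ε := Finset.sum_le_sum fun l _ => by
        rw [PiLp.sub_apply, partialD_apply I hf.contDiffAt, partialD_apply I hg.contDiffAt]
        have e : iteratedFDeriv ℝ I.1.val (fun y => f y l - g y l) x =
            iteratedFDeriv ℝ I.1.val (fun y => f y l) x -
              iteratedFDeriv ℝ I.1.val (fun y => g y l) x :=
          iteratedFDeriv_sub_apply (hcomp hf l) (hcomp hg l)
        have hb := h x hx l _ hm
        refine le_trans ?_ hb
        rw [← sub_apply, ← e, ← Real.norm_eq_abs]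
        refine (ContinuousMultilinearMap.le_opNorm _ _).trans ?_
        simp
    _ = k * ε := by simp

theorem CBar.sum_smul_ofContDiff (hΩ : IsCompact (closure (Ω : Set (E d)))) {ι : Type*} [Fintype ι]
    (c : ι → ℝ) {f : ι → E d → E k} (hf : ∀ j, ContDiff ℝ s (f j)) {g : E d → E k}
    (hg : ContDiff ℝ s g) (hfg : ∀ x, g x = ∑ j, c j • f j x) :
    ∑ j, c j • CBar.ofContDiff hΩ (f j) (hf j) = CBar.ofContDiff hΩ g hg := by
  refine CBar.ext_fn (funext fun x => ?_)
  rw [CBar.ofContDiff_fn, hfg]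
  simp only [CBar.fn, Submodule.coe_sum, Submodule.coe_smul, Finset.sum_apply,
    BoundedContinuousFunction.coe_sum, Pi.smul_apply, BoundedContinuousFunction.coe_smul]
  exact Finset.sum_congr rfl fun j _ => congrArg _ (CBar.ofContDiff_fn hΩ (hf j) x)

/-- The four errors are those of finite rank, of the replaced vectors (not amplified, since the
weights `a` are convex), of the replaced coefficients, and of the final network. -/
theorem norm_sub_le_of_convex_combination {G ι : Type*} [NormedAddCommGroup G] [NormedSpace ℝ G]
    [Fintype ι] {y z : G} {a c : ι → ℝ} {f g : ι → G} {δ : ℝ} (hδ : 0 ≤ δ) (ha0 : ∀ j, 0 ≤ a j)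
    (ha1 : ∑ j, a j = 1) (hy : ‖y - ∑ j, a j • f j‖ ≤ δ) (hfg : ∀ j, ‖f j - g j‖ ≤ δ)
    (hac : ∀ j, |c j - a j| ≤ δ / (1 + ∑ j, ‖g j‖)) (hz : ‖∑ j, c j • g j - z‖ ≤ δ) :
    ‖y - z‖ ≤ δ + δ + δ + δ := by
  have h2 : ‖∑ j, a j • f j - ∑ j, a j • g j‖ ≤ δ := by
    rw [← Finset.sum_sub_distrib]
    calc _ ≤ ∑ j, a j * δ := norm_sum_le_of_le _ fun j _ => by
          rw [← smul_sub, norm_smul, Real.norm_of_nonneg (ha0 j)]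
          exact mul_le_mul_of_nonneg_left (hfg j) (ha0 j)
      _ = δ := by rw [← Finset.sum_mul, ha1, one_mul]
  have h3 : ‖∑ j, a j • g j - ∑ j, c j • g j‖ ≤ δ := by
    have hB : 0 < 1 + ∑ j, ‖g j‖ := by positivity
    rw [← Finset.sum_sub_distrib]
    calc _ ≤ ∑ j, δ / (1 + ∑ j, ‖g j‖) * ‖g j‖ := norm_sum_le_of_le _ fun j _ => by
          rw [← sub_smul, norm_smul, norm_sub_rev, Real.norm_eq_abs]
          exact mul_le_mul_of_nonneg_right (hac j) (norm_nonneg _)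
      _ ≤ δ / (1 + ∑ j, ‖g j‖) * (1 + ∑ j, ‖g j‖) := by
          rw [← Finset.mul_sum]
          exact mul_le_mul_of_nonneg_left (by simp) (by positivity)
      _ = δ := by field_simp
  calc _ = ‖(y - ∑ j, a j • f j) + (∑ j, a j • f j - ∑ j, a j • g j) +
        (∑ j, a j • g j - ∑ j, c j • g j) + (∑ j, c j • g j - z)‖ := by congr 1; abel
    _ ≤ δ + δ + δ + δ := norm_add₄_le.trans (by gcongr)

end Comparison

end ANO

/-! ### The universal approximation theorem -/

theorem theorem1 (d k k' s s' : ℕ) (σ : ℝ → ℝ) (hσ : ANO.IsActivation σ)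
    (Ω : TopologicalSpace.Opens (ANO.E d))
    (hΩ : ANO.IsBoundedLipschitzDomain (Ω : Set (ANO.E d)))
    (Ψd : ANO.CBar d k s Ω → ANO.CBar d k' s' Ω) (hΨd : Continuous Ψd)
    (K : Set (ANO.CBar d k s Ω)) (hK : IsCompact K) (ε : ℝ) (hε : 0 < ε) :
    ∃ (c : ℕ) (θ : ANO.Params d k k' c) (Ψ : ANO.CBar d k s Ω → ANO.CBar d k' s' Ω),
      (∀ u x, (Ψ u).fn x = θ.apply Ω σ u.fn x) ∧
      ∀ u ∈ K, ‖Ψd u - Ψ u‖ ≤ ε := by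
  classical
  have hΩc := hΩ.isCompact_closure
  have := isCompact_iff_compactSpace.1 hK
  have hε4 : 0 < ε / 4 := by positivity
  obtain ⟨T, α, hα0, hα1, hα⟩ := ANO.exists_finite_rank_approx (X := K)
    (G := ANO.CBar d k' s' Ω) (F := fun u => Ψd u.1) (hΨd.comp continuous_subtype_val) hε4
  choose q hq hqη using fun j : T => ANO.CBar.exists_polyFun_approx hΩ (Ψd j.1.1) hε4
  have hqs : ∀ j, ContDiff ℝ s' (q j) := fun j => ANO.contDiff_of_forall_mem_polyFun (hq j)
  let η : T → ANO.CBar d k' s' Ω := fun j => ANO.CBar.ofContDiff hΩc (q j) (hqs j)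
  choose p hp using fun j : T => ANO.exists_mvPolynomial_feature_approx hσ hΩc hK (α j)
    (show 0 < ε / 4 / (1 + ∑ j, ‖η j‖) by positivity)
  -- All the polynomials `p j` together involve finitely many features; these become the channels
  -- read by `Q`.
  let S : Finset (ANO.ridge σ (ANO.E k × ANO.E d) × ℝ) := Finset.univ.biUnion fun j => (p j).vars
  have hren : ∀ j, ∃ p' : MvPolynomial S ℝ, MvPolynomial.rename Subtype.val p' = p j := fun j =>
    MvPolynomial.exists_rename_eq_of_vars_subset_range (p j) Subtype.val Subtype.val_injective (by
      rw [Subtype.range_coe]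
      exact_mod_cast Finset.subset_biUnion_of_mem (fun j => (p j).vars) (Finset.mem_univ j))
  choose p' hp' using hren
  -- Defined on the whole space, not only on `K`, because the operator must act on every `u`.
  let w : ANO.CBar d k s Ω → S → ℝ := fun u i => σ (i.1.2 + ANO.avg Ω i.1.1.1 u.fn)
  have hw : ∀ (u : K) j, |MvPolynomial.eval (w u.1) (p' j) - α j u| ≤ ε / 4 / (1 + ∑ j, ‖η j‖) := by
    intro u j
    have h := hp j u
    rw [← hp' j, MvPolynomial.eval_rename] at h
    exact h
  have hwc : Continuous fun u : K => w u.1 := continuous_pi fun i =>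
    (ANO.feature hσ hΩc hK i.1).continuous
  let P : Fin k' → (S → ℝ) × ANO.E d → ℝ := fun l z =>
    ∑ j, MvPolynomial.eval z.1 (p' j) * q j z.2 l
  have hP : ∀ l, P l ∈ ANO.polyFun ((S → ℝ) × ANO.E d) := by
    intro l
    have : P l = ∑ j, (fun z : (S → ℝ) × ANO.E d => MvPolynomial.eval z.1 (p' j)) *
        fun z : (S → ℝ) × ANO.E d => q j z.2 l := by
      ext z; simp [P, Finset.sum_apply]
    rw [this]
    exact sum_mem fun j _ => mul_mem (ANO.eval_mem_polyFun (p' j))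
      (ANO.comp_mem_polyFun (hq j l) (ContinuousLinearMap.snd ℝ (S → ℝ) (ANO.E d)))
  -- The `k'` components are estimated separately and summed; `+ 1` covers `k' = 0`.
  have hε' : 0 < ε / (4 * (k' + 1)) := by positivity
  -- The approximation is joint in `(w, x)` on a compact product, hence uniform over `u ∈ K` after
  -- freezing `w`.
  have happ : ∀ l, ∃ N ∈ ANO.ridge σ ((S → ℝ) × ANO.E d), ContDiff ℝ ∞ N ∧
      ∀ z ∈ (Set.range fun u : K => w u.1) ×ˢ closure (Ω : Set (ANO.E d)), ∀ i ≤ s',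
        ‖iteratedFDeriv ℝ i (P l - N) z‖ ≤ ε / (4 * (k' + 1)) := fun l =>
    (ANO.polyFun_le_crClosure_ridge hσ s' ((isCompact_range hwc).prod hΩc) (hP l)).2 _ hε'
  choose N hN hNs hPN using happ
  obtain ⟨c, θ, hθ⟩ := ANO.exists_params Ω σ (fun i : S => i.1.1) (fun i => i.1.2)
    fun l => ⟨N l, hN l⟩
  have hsl : ∀ {f : (S → ℝ) × ANO.E d → ℝ}, ContDiff ℝ ∞ f → ∀ z,
      ContDiff ℝ s' fun x => f (z, x) := fun hf z =>
    (hf.comp (contDiff_const.prodMk contDiff_id)).of_le (mod_cast le_top)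
  have hNw : ∀ z : S → ℝ, ContDiff ℝ s' fun x : ANO.E d =>
      (WithLp.toLp 2 fun l => N l (z, x) : ANO.E k') := fun z =>
    contDiff_euclidean.2 fun l => hsl (hNs l) z
  have hPs : ∀ l, ContDiff ℝ ∞ (P l) := fun l => ANO.contDiff_of_mem_polyFun (hP l)
  have hPw : ∀ z : S → ℝ, ContDiff ℝ s' fun x : ANO.E d =>
      (WithLp.toLp 2 fun l => P l (z, x) : ANO.E k') := fun z =>
    contDiff_euclidean.2 fun l => hsl (hPs l) z
  refine ⟨c, θ, fun u => ANO.CBar.ofContDiff hΩc _ (hNw (w u)), fun u x => ?_, fun u hu => ?_⟩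
  · rw [ANO.CBar.ofContDiff_fn, hθ]
  · have hsum := ANO.CBar.sum_smul_ofContDiff hΩc (fun j => MvPolynomial.eval (w u) (p' j)) hqs
      (hPw (w u)) fun x => by ext l; simp [P, Finset.sum_apply]
    have hlast : ‖ANO.CBar.ofContDiff hΩc _ (hPw (w u)) -
        ANO.CBar.ofContDiff hΩc _ (hNw (w u))‖ ≤ ε / 4 := by
      refine (ANO.CBar.norm_ofContDiff_sub_le hΩc (hPw (w u)) (hNw (w u)) hε'.le
        fun x hx l m hm => ?_).trans ?_
      · exact (ANO.norm_iteratedFDeriv_prodMk_left_le ((hPs l).sub (hNs l)) (w u) x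
          (mod_cast le_top)).trans (hPN l _ ⟨⟨⟨u, hu⟩, rfl⟩, subset_closure hx⟩ m hm)
      · calc (k' : ℝ) * (ε / (4 * (k' + 1))) ≤ (k' + 1) * (ε / (4 * (k' + 1))) := by
              gcongr; linarith
          _ = ε / 4 := by field_simp
    rw [← hsum] at hlast
    have hfin := ANO.norm_sub_le_of_convex_combination hε4.le (fun j => hα0 j ⟨u, hu⟩)
      (hα1 ⟨u, hu⟩) (hα ⟨u, hu⟩) hqη (hw ⟨u, hu⟩) hlast
    exact hfin.trans (by linarith)
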